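/- Conventions. All Hilbert spaces are complex. $\mathbb P(E)$ is the set of bounded operators $X$ on $E$ with $X\ge\varepsilon I$ for some $\varepsilon>0$, and $\mathbb P_{c_1,c_2}(E)=\{X\in\mathbb P(E): c_1I\le X\le c_2I\}$. Let $k\ge 1$. A free function $F:\mathbb P^k\to\mathbb P$ assigns to each Hilbert space $E$ a map $F:\mathbb P(E)^k\to\mathbb P(E)$ such that $F(U^*A_1U,\dots,U^*A_kU)=U^*F(A)U$ for all unitaries $U$ on $E$ and $F(A_1\oplus B_1,\dots,A_k\oplus B_k)=F(A)\oplus F(B)$ for $A\in\mathbb P(E)^k$, $B\in\mathbb P(E')^k$. It is operator monotone if $A_i\le B_i$ for all $i$ implies $F(A)\le F(B)$, for all $E$ and $A,B\in\mathbb P(E)^k$. Fix $c_2>c_1>0$. Let $\Omega$ be the set of all triples $(n,A,v)$ with $n\ge1$, $A\in\mathbb P_{c_1,c_2}(\mathbb C^n)^k$ and $v\in\mathbb C^n$ a unit vector, and let $\mathcal H=\bigoplus_{(n,A,v)\in\Omega}(\mathbb C^n)^*$ (Hilbert space direct sum). Write $v^*=\langle v,\cdot\rangle\in(\mathbb C^n)^*$,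 let $P_v$ be the orthogonal projection of $(\mathbb C^n)^*$ onto $\mathbb C v^*$, and let $\mathbf 1=\sum_j e_j^*\otimes e_j\in(\mathbb C^n)^*\otimes\mathbb C^n$. A supporting pencil of $F$ at $(n,A,v)\in\Omega$ is given by operators $B_0,\dots,B_k\ge0$ on $(\mathbb C^n)^*$ such that, with $L(Y,X)=B_0\otimes I-P_v\otimes Y+\sum_{i=1}^kB_i\otimes(X_i-I)$, 1. $\sum_{i=1}^kB_i\le B_0$; 2. $L(Y,X)\ge0$ on $(\mathbb C^n)^*\otimes K$ for every Hilbert space $K$, $X\in\mathbb P(K)^k$ and self-adjoint $Y\le F(X)$; 3. $\langle \mathbf 1,L(F(A),A)\mathbf 1\rangle=0$; 4. $\operatorname{tr}B_0\le F(c_2,\dots,c_2)/\min(1,c_1)$, where $F(c_2,\dots,c_2)$ is the value of $F$ at the scalars $c_2$ (on $E=\mathbb C$). For a choice of a supporting pencil $B_i(A,v)$ at each $(n,A,v)\in\Omega$ put $P_1=P_v$, $P_2=I-P_v$, $B_{i,xy}(A,v)=P_xB_i(A,v)P_y$ and $B_{i,xy}=\bigoplus_{\Omega}B_{i,xy}(A,v)$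 for $x,y\in\{1,2\}$. For $X\in\mathbb P_{c_1,c_2}(E)^k$ with $\dim E<\infty$ put $L_{xy}(X)=B_{0,xy}\otimes I+\sum_{i=1}^kB_{i,xy}\otimes(X_i-I)$, and define $L_{xy}^{A,v}(X)$ in the same way from $B_{i,xy}(A,v)$. Let $$\Psi_F(X)=\bigoplus_{(n,A,v)\in\Omega}\left\{L_{11}^{A,v}(X)-L_{12}^{A,v}(X)\,L_{22}^{A,v}(X)^{-1}\,L_{21}^{A,v}(X)\right\},$$ where the inverse of a positive semidefinite matrix is taken on its range and extended by $0$ to its kernel. For a bounded positive operator $D$ with $T_{21}=D^{1/2}C_{21}$, $T_{12}=C_{12}D^{1/2}$, $C_{12},C_{21}$ bounded, $\operatorname{ran}C_{21}\subseteq(\ker D)^\perp$ and $C_{12}|_{\ker D}=0$, the product $T_{12}D^{-1}T_{21}$ denotes $C_{12}C_{21}$. For a state $w$ on $\mathcal B(\mathcal H)$, $(w\otimes I)(T)$ is the operator on $E$ with $\langle x,(w\otimes I)(T)y\rangle=w\big((I\otimes x^*)T(I\otimes y)\big)$. Theorem 4.6. Let $F:\mathbb P^k\to\mathbb P$ be an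 operator monotone free function and $c_2>c_1>0$. Then supporting pencils of $F$ exist at all points of $\Omega$. Moreover, for any choice of supporting pencils $B_i(A,v)$, $(n,A,v)\in\Omega$, the operators $B_{i,xy}$ on $\mathcal H$ are bounded, and there is a state $w$ on $\mathcal B(\mathcal H)$ such that for every finite-dimensional Hilbert space $E$ and every $X\in\mathbb P_{c_1,c_2}(E)^k$ the operator $\Psi_F(X)$ is bounded on $\mathcal H\otimes E$, the product $L_{12}(X)L_{22}(X)^{-1}L_{21}(X)$ exists as a bounded operator, and $$F(X)=(w\otimes I)(\Psi_F(X))=w(B_{0,11})I+\sum_{i=1}^kw(B_{i,11})(X_i-I)-(w\otimes I)\left\{L_{12}(X)\,L_{22}(X)^{-1}\,L_{21}(X)\right\}.$$ -/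

import Mathlib

open scoped TensorProduct InnerProductSpace ComplexOrder ComplexConjugate

universe u

noncomputable section

namespace FreeLoewner

/-! ### Positive operators, free functions, operator monotonicity -/

/-- The cone `ℙ(E)` of positive definite (that is, bounded below by a positive multiple of the
identity) operators. The order is the Loewner order. -/
def PosOp (E : Type*) [NormedAddCommGroup E] [InnerProductSpace ℂ E] : Set (E →L[ℂ] E) :=
  {X | ∃ ε : ℝ, 0 < ε ∧ (ε : ℂ) • (1 : E →L[ℂ] E) ≤ X}

/-- The order interval `ℙ_{c₁,c₂}(E)`. -/
def PosOpIcc (c₁ c₂ : ℝ) (E : Type*) [NormedAddCommGroup E] [InnerProductSpace ℂ E] :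
    Set (E →L[ℂ] E) :=
  {X | X ∈ PosOp E ∧ (c₁ : ℂ) • (1 : E →L[ℂ] E) ≤ X ∧ X ≤ (c₂ : ℂ) • (1 : E →L[ℂ] E)}

/-- A graded operator function of `k` operator variables: one function for each Hilbert space.
Only its values on `ℙ(E)^k` matter. -/
abbrev GradedFunction (k : ℕ) : Type _ :=
  ∀ (E : Type u) [NormedAddCommGroup E] [InnerProductSpace ℂ E] [CompleteSpace E],
    (Fin k → (E →L[ℂ] E)) → (E →L[ℂ] E)

/-- The block diagonal operator `A ⊕ B` on the Hilbert space direct sum of `E₁` and `E₂`. -/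
def dsum {E₁ E₂ : Type*} [NormedAddCommGroup E₁] [InnerProductSpace ℂ E₁]
    [NormedAddCommGroup E₂] [InnerProductSpace ℂ E₂] (A : E₁ →L[ℂ] E₁) (B : E₂ →L[ℂ] E₂) :
    WithLp 2 (E₁ × E₂) →L[ℂ] WithLp 2 (E₁ × E₂) :=
  (WithLp.prodContinuousLinearEquiv 2 ℂ E₁ E₂).symm.toContinuousLinearMap ∘L
    (A.prodMap B) ∘L (WithLp.prodContinuousLinearEquiv 2 ℂ E₁ E₂).toContinuousLinearMap

/-- `F : ℙ^k → ℙ` is a free (noncommutative) function: it takes values in `ℙ`, and it respects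
unitary conjugation and direct sums. -/
structure IsFreeFunction {k : ℕ} (F : GradedFunction.{u} k) : Prop where
  maps_to : ∀ (E : Type u) [NormedAddCommGroup E] [InnerProductSpace ℂ E] [CompleteSpace E]
    (A : Fin k → (E →L[ℂ] E)), (∀ i, A i ∈ PosOp E) → F E A ∈ PosOp E
  unitary_conj : ∀ (E : Type u) [NormedAddCommGroup E] [InnerProductSpace ℂ E] [CompleteSpace E]
    (U : E →L[ℂ] E), U ∈ unitary (E →L[ℂ] E) →
    ∀ A : Fin k → (E →L[ℂ] E), (∀ i, A i ∈ PosOp E) →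
      F E (fun i => star U * A i * U) = star U * F E A * U
  direct_sum : ∀ (E₁ E₂ : Type u)
    [NormedAddCommGroup E₁] [InnerProductSpace ℂ E₁] [CompleteSpace E₁]
    [NormedAddCommGroup E₂] [InnerProductSpace ℂ E₂] [CompleteSpace E₂]
    (A : Fin k → (E₁ →L[ℂ] E₁)) (B : Fin k → (E₂ →L[ℂ] E₂)),
    (∀ i, A i ∈ PosOp E₁) → (∀ i, B i ∈ PosOp E₂) →
      F (WithLp 2 (E₁ × E₂)) (fun i => dsum (A i) (B i)) = dsum (F E₁ A) (F E₂ B)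

/-- Operator monotonicity on `ℙ^k`, over all Hilbert spaces. -/
def IsOperatorMonotone {k : ℕ} (F : GradedFunction.{u} k) : Prop :=
  ∀ (E : Type u) [NormedAddCommGroup E] [InnerProductSpace ℂ E] [CompleteSpace E]
    (A B : Fin k → (E →L[ℂ] E)), (∀ i, A i ∈ PosOp E) → (∀ i, B i ∈ PosOp E) →
    (∀ i, A i ≤ B i) → F E A ≤ F E B

/-- The hypograph of `F` at the Hilbert space `K`: the pairs `(Y, X)` with `Y` self-adjoint,
`X ∈ ℙ(K)^k` and `Y ≤ F(X)`. -/
def hypograph {k : ℕ} (F : GradedFunction.{u} k) (K : Type u) [NormedAddCommGroup K]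
    [InnerProductSpace ℂ K] [CompleteSpace K] : Set ((K →L[ℂ] K) × (Fin k → (K →L[ℂ] K))) :=
  {p | IsSelfAdjoint p.1 ∧ (∀ i, p.2 i ∈ PosOp K) ∧ p.1 ≤ F K p.2}

/-! ### Linear pencils and their supporting property -/

/-- The linear pencil `B₀ ⊗ I + ∑ i, Bᵢ ⊗ (Xᵢ - I)` on `V ⊗ K`. -/
def pencil {k : ℕ} {V K : Type*} [NormedAddCommGroup V] [InnerProductSpace ℂ V]
    [NormedAddCommGroup K] [InnerProductSpace ℂ K]
    (B : Fin (k + 1) → (V →L[ℂ] V)) (X : Fin k → (K →L[ℂ] K)) :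
    V ⊗[ℂ] K →L[ℂ] V ⊗[ℂ] K :=
  TensorProduct.mapL (B 0) 1 + ∑ i : Fin k, TensorProduct.mapL (B i.succ) (X i - 1)

/-- The `n`-dimensional Hilbert space `ℂⁿ` (in an arbitrary universe); these represent all
finite-dimensional Hilbert spaces up to isomorphism. It also serves as the coordinate model of the
dual `(ℂⁿ)*`, the functional `⟪eᵢ, ·⟫` corresponding to `eᵢ`. -/
abbrev Coord (n : ℕ) : Type u := EuclideanSpace ℂ (ULift.{u} (Fin n))

/-- The functional `v* = ⟪v, ·⟫` in the coordinates of the dual `(ℂⁿ)*`, i.e. the entrywise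
conjugate of `v`. -/
def dualVec {n : ℕ} (v : Coord.{u} n) : Coord.{u} n := WithLp.toLp 2 fun i => conj (v i)

/-- The projection of `(ℂⁿ)*` onto the line spanned by `v*`, for a unit vector `v`. -/
def dualProj {n : ℕ} (v : Coord.{u} n) : Coord.{u} n →L[ℂ] Coord.{u} n :=
  InnerProductSpace.rankOne ℂ (dualVec v) (dualVec v)

/-- The canonical vector `∑ i, eᵢ* ⊗ eᵢ` of `(ℂⁿ)* ⊗ ℂⁿ`, which represents the identity
of `ℂⁿ`. -/
def canonicalVec (n : ℕ) : Coord.{u} n ⊗[ℂ] Coord.{u} n :=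
  ∑ i : ULift.{u} (Fin n), EuclideanSpace.single i (1 : ℂ) ⊗ₜ[ℂ] EuclideanSpace.single i (1 : ℂ)

/-- `B = (B₀, …, B_k)` are the coefficients, operators on `(ℂⁿ)*`, of a pencil
`L(Y, X) = B₀ ⊗ I - (v*)(v*)* ⊗ Y + ∑ i, Bᵢ ⊗ (Xᵢ - I)` that supports the hypograph of `F`
at `(F(A), A)` in the direction of the unit vector `v`, where `A ∈ ℙ_{c₁,c₂}(ℂⁿ)^k`. -/
structure IsSupportingPencil {k : ℕ} (F : GradedFunction.{u} k) (c₁ c₂ : ℝ) {n : ℕ}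
    (A : Fin k → (Coord.{u} n →L[ℂ] Coord.{u} n)) (v : Coord.{u} n)
    (B : Fin (k + 1) → (Coord.{u} n →L[ℂ] Coord.{u} n)) : Prop where
  nonneg : ∀ i, (B i).IsPositive
  sum_le : ∑ i : Fin k, B i.succ ≤ B 0
  nonneg_on_hypograph : ∀ (K : Type u) [NormedAddCommGroup K] [InnerProductSpace ℂ K]
    [CompleteSpace K] (Y : K →L[ℂ] K) (X : Fin k → (K →L[ℂ] K)), (Y, X) ∈ hypograph F K →
    (pencil B X - TensorProduct.mapL (dualProj v) Y).IsPositive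
  singular : ⟪canonicalVec n, (pencil B A - TensorProduct.mapL (dualProj v) (F (Coord.{u} n) A))
    (canonicalVec n)⟫_ℂ = 0
  /-- The norm is the value of the scalar `F(c₂, …, c₂)`. -/
  trace_le : (LinearMap.trace ℂ (Coord.{u} n) (B 0).toLinearMap).re ≤
    ‖F (Coord.{u} 1) (fun _ => (c₂ : ℂ) • 1)‖ / min 1 c₁

/-! ### The Hilbert space `ℋ` and direct sums of operators -/

/-- The index set of `ℋ`: a dimension `n`, a tuple `A ∈ ℙ_{c₁,c₂}(ℂⁿ)^k`, a unit vector `v`. -/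
structure Index (k : ℕ) (c₁ c₂ : ℝ) : Type u where
  n : ℕ
  A : Fin k → (Coord.{u} n →L[ℂ] Coord.{u} n)
  v : Coord.{u} n
  A_mem : ∀ i, A i ∈ PosOpIcc c₁ c₂ (Coord.{u} n)
  norm_v : ‖v‖ = 1

/-- The (non-separable) Hilbert space direct sum `ℋ = ⨁_{(n, A, v)} (ℂⁿ)*`. -/
abbrev BigSpace (k : ℕ) (c₁ c₂ : ℝ) : Type u :=
  lp (fun ω : Index.{u} k c₁ c₂ => Coord.{u} ω.n) 2

/-- A choice of one pencil for each index. -/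
abbrev PencilSystem (k : ℕ) (c₁ c₂ : ℝ) : Type u :=
  ∀ ω : Index.{u} k c₁ c₂, Fin (k + 1) → (Coord.{u} ω.n →L[ℂ] Coord.{u} ω.n)

/-- All pencils of the system are supporting pencils of the hypograph of `F`. -/
def IsSupportingSystem {k : ℕ} {c₁ c₂ : ℝ} (F : GradedFunction.{u} k)
    (B : PencilSystem.{u} k c₁ c₂) : Prop :=
  ∀ ω : Index.{u} k c₁ c₂, IsSupportingPencil F c₁ c₂ ω.A ω.v (B ω)

open Classical in
/-- The inclusion of a summand into `ℋ`. -/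
def incl {k : ℕ} {c₁ c₂ : ℝ} (ω : Index.{u} k c₁ c₂) :
    Coord.{u} ω.n →L[ℂ] BigSpace.{u} k c₁ c₂ :=
  lp.singleContinuousLinearMap ℂ (fun ω : Index.{u} k c₁ c₂ => Coord.{u} ω.n) 2 ω

/-- The bounded operator `T` on `ℋ` is the direct sum of the operators `t ω`. -/
def IsDirectSum {k : ℕ} {c₁ c₂ : ℝ} (T : BigSpace.{u} k c₁ c₂ →L[ℂ] BigSpace.{u} k c₁ c₂)
    (t : ∀ ω : Index.{u} k c₁ c₂, Coord.{u} ω.n →L[ℂ] Coord.{u} ω.n) : Prop :=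
  ∀ ω x, T (incl ω x) = incl ω (t ω x)

/-- The bounded operator `T` on `ℋ ⊗ E = ⨁ ((ℂⁿ)* ⊗ E)` is the direct sum of the operators
`t ω`. For finite-dimensional `E` the algebraic tensor product is the Hilbert space tensor
product. -/
def IsDirectSumTensor {k : ℕ} {c₁ c₂ : ℝ} {E : Type*} [NormedAddCommGroup E]
    [InnerProductSpace ℂ E]
    (T : BigSpace.{u} k c₁ c₂ ⊗[ℂ] E →L[ℂ] BigSpace.{u} k c₁ c₂ ⊗[ℂ] E)
    (t : ∀ ω : Index.{u} k c₁ c₂, Coord.{u} ω.n ⊗[ℂ] E →L[ℂ] Coord.{u} ω.n ⊗[ℂ] E) : Prop :=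
  ∀ ω x, T (TensorProduct.mapL (incl ω) 1 x) = TensorProduct.mapL (incl ω) 1 (t ω x)

/-! ### Blocks, generalized inverses and Schur complements -/

/-- The `(x, y)` block of `B` with respect to the projection `P`: index `0` of `Fin 2` stands
for the range of `P`, index `1` for its orthogonal complement. -/
def block {V : Type*} [NormedAddCommGroup V] [InnerProductSpace ℂ V] (P : V →L[ℂ] V)
    (x y : Fin 2) (B : V →L[ℂ] V) : V →L[ℂ] V :=
  ![P, 1 - P] x * B * ![P, 1 - P] y

instance completeSpace_tensor {V E : Type*} [NormedAddCommGroup V] [InnerProductSpace ℂ V]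
    [NormedAddCommGroup E] [InnerProductSpace ℂ E] [FiniteDimensional ℂ V]
    [FiniteDimensional ℂ E] : CompleteSpace (V ⊗[ℂ] E) :=
  FiniteDimensional.complete ℂ (V ⊗[ℂ] E)

/-- The inverse of a self-adjoint operator `D` on a finite-dimensional Hilbert space, taken on the
range of `D` and extended by `0` to the kernel of `D`: each eigenvalue `x` is replaced by `x⁻¹`,
where `0⁻¹ = 0`. -/
def genInv {V : Type*} [NormedAddCommGroup V] [InnerProductSpace ℂ V] [CompleteSpace V]
    (D : V →L[ℂ] V) : V →L[ℂ] V :=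
  cfc (fun x : ℝ => x⁻¹) D

/-- The summand of `Ψ_F(X)` at the index `ω`: the Schur complement, on `(ℂⁿ)* ⊗ E` and with
respect to the subspace `ℂ v* ⊗ E`, of the pencil with coefficients `B`. -/
def schurBlock {k n : ℕ} (v : Coord.{u} n)
    (B : Fin (k + 1) → (Coord.{u} n →L[ℂ] Coord.{u} n))
    {E : Type*} [NormedAddCommGroup E] [InnerProductSpace ℂ E] [FiniteDimensional ℂ E]
    (X : Fin k → (E →L[ℂ] E)) : Coord.{u} n ⊗[ℂ] E →L[ℂ] Coord.{u} n ⊗[ℂ] E :=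
  pencil (fun i => block (dualProj v) 0 0 (B i)) X -
    pencil (fun i => block (dualProj v) 0 1 (B i)) X *
      genInv (pencil (fun i => block (dualProj v) 1 1 (B i)) X) *
      pencil (fun i => block (dualProj v) 1 0 (B i)) X

/-- `Q` is the product `T₁₂ D⁻¹ T₂₁`, where `D` is a positive operator whose range need not be
closed. It is understood as `(T₁₂ D^{-1/2}) (D^{-1/2} T₂₁)`: here `S = D^{1/2}`, the bounded
operator `C₂₁ = S⁻¹ T₂₁` has range in `(ker S)ᗮ`, and `C₁₂ = T₁₂ S⁻¹` vanishes on `ker S`. These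
conditions determine `Q`. -/
def IsInverseSandwich {V : Type*} [NormedAddCommGroup V] [InnerProductSpace ℂ V]
    (T₁₂ D T₂₁ Q : V →L[ℂ] V) : Prop :=
  ∃ S C₁₂ C₂₁ : V →L[ℂ] V, S.IsPositive ∧ S * S = D ∧
    T₂₁ = S * C₂₁ ∧ (∀ x, C₂₁ x ∈ (LinearMap.ker S.toLinearMap)ᗮ) ∧
    T₁₂ = C₁₂ * S ∧ (∀ x, S x = 0 → C₁₂ x = 0) ∧
    Q = C₁₂ * C₂₁

/-! ### States and the slice map `w ⊗ I` -/

/-- `w` is a state of the C⋆-algebra of bounded operators on `H`. -/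
structure IsState {H : Type*} [NormedAddCommGroup H] [InnerProductSpace ℂ H]
    (w : StrongDual ℂ (H →L[ℂ] H)) : Prop where
  map_one : w 1 = 1
  nonneg : ∀ T : H →L[ℂ] H, T.IsPositive → 0 ≤ w T

/-- The operator `(I ⊗ x*) T (I ⊗ y)` on `H`, for `T` on `H ⊗ E` and `x y : E`. -/
def compress {H E : Type*} [NormedAddCommGroup H] [InnerProductSpace ℂ H]
    [NormedAddCommGroup E] [InnerProductSpace ℂ E] (x y : E)
    (T : H ⊗[ℂ] E →L[ℂ] H ⊗[ℂ] E) : H →L[ℂ] H :=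
  (TensorProduct.ridIsometry ℂ H).toContinuousLinearEquiv.toContinuousLinearMap ∘L
    TensorProduct.mapL 1 (innerSL ℂ x) ∘L T ∘L (TensorProduct.mkL ℂ H E).flip y

/-- The slice map `w ⊗ I` from operators on `H ⊗ E` to operators on the finite-dimensional
space `E`, through the identification of operators on `H ⊗ E` with matrices of operators
on `H`. -/
def slice {H E : Type*} [NormedAddCommGroup H] [InnerProductSpace ℂ H]
    [NormedAddCommGroup E] [InnerProductSpace ℂ E] [FiniteDimensional ℂ E]
    (w : StrongDual ℂ (H →L[ℂ] H)) (T : H ⊗[ℂ] E →L[ℂ] H ⊗[ℂ] E) : E →L[ℂ] E :=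
  ∑ i, ∑ j, w (compress (stdOrthonormalBasis ℂ E i) (stdOrthonormalBasis ℂ E j) T) •
    InnerProductSpace.rankOne ℂ (stdOrthonormalBasis ℂ E i) (stdOrthonormalBasis ℂ E j)

/-- `slice w T` is the operator with `⟪x, (w ⊗ I)(T) y⟫ = w ((I ⊗ x*) T (I ⊗ y))`, so it does not
depend on the choice of basis. -/
theorem inner_slice {H E : Type*} [NormedAddCommGroup H] [InnerProductSpace ℂ H]
    [NormedAddCommGroup E] [InnerProductSpace ℂ E] [FiniteDimensional ℂ E]
    (w : StrongDual ℂ (H →L[ℂ] H)) (T : H ⊗[ℂ] E →L[ℂ] H ⊗[ℂ] E) (x y : E) :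
    ⟪x, slice w T y⟫_ℂ = w (compress x y T) := by
  have h : compress x y T = ∑ i, ∑ j, (⟪x, stdOrthonormalBasis ℂ E i⟫_ℂ *
      ⟪stdOrthonormalBasis ℂ E j, y⟫_ℂ) •
      compress (stdOrthonormalBasis ℂ E i) (stdOrthonormalBasis ℂ E j) T := by
    have hx : innerSL ℂ x = ∑ i, ⟪x, stdOrthonormalBasis ℂ E i⟫_ℂ •
        innerSL ℂ (stdOrthonormalBasis ℂ E i) := by
      ext z
      simp [(stdOrthonormalBasis ℂ E).sum_inner_mul_inner]
    have hm : ∀ u : H ⊗[ℂ] E, TensorProduct.rid ℂ H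
        (TensorProduct.map LinearMap.id (innerSL ℂ x).toLinearMap u) =
        ∑ i, ⟪x, stdOrthonormalBasis ℂ E i⟫_ℂ • TensorProduct.rid ℂ H
          (TensorProduct.map LinearMap.id
            (innerSL ℂ (stdOrthonormalBasis ℂ E i)).toLinearMap u) := by
      intro u
      induction u using TensorProduct.induction_on with
      | zero => simp
      | tmul a b =>
        simp only [TensorProduct.map_tmul, TensorProduct.rid_tmul, LinearMap.id_apply]
        have := congrArg (fun f => f b • a) hx
        simpa [Finset.sum_smul, smul_smul] using this
      | add a b ha hb => simp only [map_add, ha, hb, smul_add, Finset.sum_add_distrib]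
    ext a
    have hy : a ⊗ₜ[ℂ] y = ∑ j, ⟪stdOrthonormalBasis ℂ E j, y⟫_ℂ •
        (a ⊗ₜ[ℂ] stdOrthonormalBasis ℂ E j) := by
      conv_lhs => rw [← (stdOrthonormalBasis ℂ E).sum_repr' y]
      simp [TensorProduct.tmul_sum]
    simp only [compress, ContinuousLinearMap.comp_apply, ContinuousLinearMap.flip_apply,
      TensorProduct.mkL_apply_apply, TensorProduct.mapL_apply, FunLike.coe_sum,
      Finset.sum_apply, smul_apply]
    erw [hm]
    rw [hy]
    simp only [map_sum, map_smul, Finset.smul_sum, smul_smul]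
    rfl
  rw [h]
  simp only [slice, map_sum, map_smul, FunLike.coe_sum, Finset.sum_apply,
    inner_sum, smul_apply, inner_smul_right,
    InnerProductSpace.rankOne_apply, smul_eq_mul]
  refine Finset.sum_congr rfl fun i _ => Finset.sum_congr rfl fun j _ => ?_
  ring

end FreeLoewner

end

/-!
A separation argument produces the pencils, and compactness of the state space glues them together.

*Existence of pencils.* An operator monotone free function satisfies a compression inequality:
if `T` is a strict contraction and each `T* Xᵢ T` lies strictly below `Aᵢ`, then
`T* F(X) T ≤ F(A)`. For an isometry `T` this holds because `Xᵢ` is dominated by the block diagonal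
operator with blocks `Aᵢ` and a large scalar, on which `F` acts blockwise; a strict
contraction is a corner of an isometry into a larger space (`compression_le`). The inequality says that the
point `(1, A, ⟪v, F(A) v⟫)` avoids an open convex cone built from the hypographs of `F` over all spaces at
once, and a separating functional is a matrix pencil that supports `F` at `(A, v)`
(`exists_supportingPencil`).

*Value at the supporting point.* The pencil minus `P_v ⊗ F(A)` is positive and its quadratic form
vanishes at the canonical vector, hence it annihilates that vector. Passing to Schur complements
shows that the Schur complement of the pencil at `A` maps `v* ⊗ v` to `v* ⊗ F(A) v`
(`IsSupportingPencil.schurBlock_apply_self`). If `X` is a direct summand of `A`, embedded by `J`,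
the same holds at `X` with `J* v` in place of `v`.

*Choice of the state.* Finitely many matrix tuples `X` and vectors `y` are all direct summands of
one `(A, v)`, so the vector state at `v*` in the corresponding summand of `ℋ` gives the right value
of `⟪x, F(X) y⟫` for all of them simultaneously. Weak-* compactness of the set of states yields
one state that works for all matrix tuples (`IsSupportingSystem.exists_isState`).

*Boundedness.* The trace bound makes the pencils uniformly bounded, and positivity of the Schur
complement bounds `L₂₂^{-1/2} L₂₁` by `L₁₁^{1/2}`. Hence the factors `L₂₂^{1/2}`, `L₂₂^{-1/2} L₂₁`
and `L₁₂ L₂₂^{-1/2}` sum up to bounded operators (`exists_isInverseSandwich`).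
-/

noncomputable section

namespace FreeLoewner

open ContinuousLinearMap

/-! ### Quadratic forms and the cone of positive definite operators -/

section Order

variable {E K : Type*} [NormedAddCommGroup E] [InnerProductSpace ℂ E]
  [NormedAddCommGroup K] [InnerProductSpace ℂ K]

theorem re_inner_le_of_le {A B : E →L[ℂ] E} (h : A ≤ B) (x : E) :
    (⟪x, A x⟫_ℂ).re ≤ (⟪x, B x⟫_ℂ).re := by
  have := ((ContinuousLinearMap.le_def A B).1 h).re_inner_nonneg_right x
  simpa [inner_sub_right] using this

theorem re_inner_real_smul_one (c : ℝ) (x : E) :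
    (⟪x, ((c : ℂ) • (1 : E →L[ℂ] E)) x⟫_ℂ).re = c * ‖x‖ ^ 2 := by
  simp only [smul_apply, one_apply_eq_self, inner_smul_right, inner_self_eq_norm_sq_to_K,
    Complex.re_ofReal_mul]
  norm_cast

theorem PosOp.of_le {A B : E →L[ℂ] E} (h : A ∈ PosOp E) (hAB : A ≤ B) : B ∈ PosOp E := by
  obtain ⟨ε, hε, h⟩ := h
  exact ⟨ε, hε, h.trans hAB⟩

theorem posOp_real_smul_one {c : ℝ} (hc : 0 < c) : (c : ℂ) • (1 : E →L[ℂ] E) ∈ PosOp E :=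
  ⟨c, hc, le_rfl⟩

@[simp] theorem dsum_apply (A : E →L[ℂ] E) (B : K →L[ℂ] K) (z : WithLp 2 (E × K)) :
    dsum A B z = WithLp.toLp 2 (A z.fst, B z.snd) := rfl

theorem PosOp.exists_le {A : E →L[ℂ] E} (h : A ∈ PosOp E) :
    ∃ ε : ℝ, 0 < ε ∧ ∀ x, ε * ‖x‖ ^ 2 ≤ (⟪x, A x⟫_ℂ).re := by
  obtain ⟨ε, hε, h⟩ := h
  exact ⟨ε, hε, fun x => by simpa only [re_inner_real_smul_one] using re_inner_le_of_le h x⟩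

variable [CompleteSpace E] [CompleteSpace K]

theorem isPositive_of_re_inner {A : E →L[ℂ] E} (hA : IsSelfAdjoint A)
    (h : ∀ x, 0 ≤ (⟪x, A x⟫_ℂ).re) : A.IsPositive := by
  refine ContinuousLinearMap.isPositive_def'.2 ⟨hA, fun x => ?_⟩
  rw [ContinuousLinearMap.reApplyInnerSelf, ← inner_conj_symm, RCLike.conj_re]
  exact h x

theorem le_of_re_inner_le {A B : E →L[ℂ] E} (hA : IsSelfAdjoint A) (hB : IsSelfAdjoint B)
    (h : ∀ x, (⟪x, A x⟫_ℂ).re ≤ (⟪x, B x⟫_ℂ).re) : A ≤ B := by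
  refine (ContinuousLinearMap.le_def A B).2 (isPositive_of_re_inner (hB.sub hA) fun x => ?_)
  have := h x
  simp only [sub_apply, inner_sub_right, Complex.sub_re]
  linarith

theorem isSelfAdjoint_real_smul_one (c : ℝ) : IsSelfAdjoint ((c : ℂ) • (1 : E →L[ℂ] E)) := by
  rw [IsSelfAdjoint, star_smul]
  simp

theorem PosOp.isSelfAdjoint {A : E →L[ℂ] E} (h : A ∈ PosOp E) : IsSelfAdjoint A := by
  obtain ⟨ε, -, h⟩ := h
  have := ((ContinuousLinearMap.le_def _ _).1 h).isSelfAdjoint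
  simpa using this.add (isSelfAdjoint_real_smul_one (E := E) ε)

theorem posOp_of_re_inner {A : E →L[ℂ] E} (hA : IsSelfAdjoint A) {ε : ℝ} (hε : 0 < ε)
    (h : ∀ x, ε * ‖x‖ ^ 2 ≤ (⟪x, A x⟫_ℂ).re) : A ∈ PosOp E :=
  ⟨ε, hε, le_of_re_inner_le (isSelfAdjoint_real_smul_one ε) hA fun x => by
    simpa only [re_inner_real_smul_one] using h x⟩

theorem PosOp.isPositive {A : E →L[ℂ] E} (h : A ∈ PosOp E) : A.IsPositive := by
  obtain ⟨ε, hε, h'⟩ := PosOp.exists_le h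
  exact isPositive_of_re_inner (PosOp.isSelfAdjoint h) fun x => le_trans (by positivity) (h' x)

theorem PosOp.re_inner_nonneg {A : E →L[ℂ] E} (h : A ∈ PosOp E) (x : E) :
    0 ≤ (⟪x, A x⟫_ℂ).re :=
  (PosOp.isPositive h).re_inner_nonneg_right x

theorem isSelfAdjoint_dsum {A : E →L[ℂ] E} {B : K →L[ℂ] K} (hA : IsSelfAdjoint A)
    (hB : IsSelfAdjoint B) : IsSelfAdjoint (dsum A B) := by
  rw [ContinuousLinearMap.isSelfAdjoint_iff_isSymmetric] at *
  intro x y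
  have h₁ := hA x.fst y.fst
  have h₂ := hB x.snd y.snd
  simp only [ContinuousLinearMap.coe_coe] at h₁ h₂
  simp only [ContinuousLinearMap.coe_coe, dsum_apply, WithLp.prod_inner_apply]
  exact congrArg₂ (· + ·) h₁ h₂

theorem posOp_dsum {A : E →L[ℂ] E} {B : K →L[ℂ] K} (hA : A ∈ PosOp E) (hB : B ∈ PosOp K) :
    dsum A B ∈ PosOp (WithLp 2 (E × K)) := by
  obtain ⟨a, ha, hA'⟩ := PosOp.exists_le hA
  obtain ⟨b, hb, hB'⟩ := PosOp.exists_le hB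
  refine posOp_of_re_inner (isSelfAdjoint_dsum (PosOp.isSelfAdjoint hA) (PosOp.isSelfAdjoint hB))
    (lt_min ha hb) fun x => ?_
  rw [WithLp.prod_norm_sq_eq_of_L2, dsum_apply, WithLp.prod_inner_apply, Complex.add_re, mul_add]
  refine add_le_add (le_trans ?_ (hA' x.fst)) (le_trans ?_ (hB' x.snd))
  · exact mul_le_mul_of_nonneg_right (min_le_left _ _) (by positivity)
  · exact mul_le_mul_of_nonneg_right (min_le_right _ _) (by positivity)

end Order

/-! ### Intertwining and compression inequalities for free functions -/

section Free

variable {k : ℕ} {F : GradedFunction.{u} k}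
  {E K : Type u} [NormedAddCommGroup E] [InnerProductSpace ℂ E] [CompleteSpace E]
  [NormedAddCommGroup K] [InnerProductSpace ℂ K] [CompleteSpace K]

/-- The self-adjoint unitary `[[0, T†], [T, 1 - T T†]]` on `E ⊕ K` attached to an isometry
`T : E → K`. -/
def isometryFlip (T : E →L[ℂ] K) : WithLp 2 (E × K) →L[ℂ] WithLp 2 (E × K) :=
  (WithLp.prodContinuousLinearEquiv 2 ℂ E K).symm.toContinuousLinearMap ∘L
    ((adjoint T ∘L snd ℂ E K).prod (T ∘L fst ℂ E K + (1 - T ∘L adjoint T) ∘L snd ℂ E K)) ∘L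
    (WithLp.prodContinuousLinearEquiv 2 ℂ E K).toContinuousLinearMap

theorem isometryFlip_apply (T : E →L[ℂ] K) (z : WithLp 2 (E × K)) :
    isometryFlip T z =
      WithLp.toLp 2 (adjoint T z.snd, T z.fst + (z.snd - T (adjoint T z.snd))) := rfl

theorem isSelfAdjoint_isometryFlip (T : E →L[ℂ] K) : IsSelfAdjoint (isometryFlip T) := by
  rw [ContinuousLinearMap.isSelfAdjoint_iff_isSymmetric]
  intro x y
  have e : ⟪T (adjoint T x.snd), y.snd⟫_ℂ = ⟪x.snd, T (adjoint T y.snd)⟫_ℂ := by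
    rw [← adjoint_inner_right, adjoint_inner_left]
  simp only [ContinuousLinearMap.coe_coe, isometryFlip_apply, WithLp.prod_inner_apply,
    WithLp.ofLp_fst, WithLp.ofLp_snd,
    inner_add_left, inner_add_right, inner_sub_left, inner_sub_right, adjoint_inner_left,
    adjoint_inner_right, e]
  ring

theorem isometryFlip_mul_self {T : E →L[ℂ] K} (hT : adjoint T ∘L T = 1) :
    isometryFlip T * isometryFlip T = 1 := by
  have h : ∀ x, adjoint T (T x) = x := fun x => congrArg (fun f => f x) hT
  refine ContinuousLinearMap.ext fun z => ?_
  have : isometryFlip T (isometryFlip T z) = WithLp.toLp 2 (z.fst, z.snd) := by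
    simp [isometryFlip_apply, h]
  exact this

/-- A free function respects isometric intertwiners: an isometry from `E` to `K` that
intertwines `A` and `Z` intertwines `F(A)` and `F(Z)`, because the unitary `isometryFlip T`
commutes with `A ⊕ Z`. -/
theorem IsFreeFunction.intertwine (hF : IsFreeFunction F) {T : E →L[ℂ] K}
    (hT : adjoint T ∘L T = 1) {A : Fin k → (E →L[ℂ] E)} {Z : Fin k → (K →L[ℂ] K)}
    (hA : ∀ i, A i ∈ PosOp E) (hZ : ∀ i, Z i ∈ PosOp K) (h : ∀ i, Z i ∘L T = T ∘L A i) :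
    F K Z ∘L T = T ∘L F E A := by
  have h' : ∀ i x, Z i (T x) = T (A i x) := fun i x => congrArg (fun f => f x) (h i)
  have hTT : ∀ x, adjoint T (T x) = x := fun x => congrArg (fun f => f x) hT
  have h'' : ∀ i y, adjoint T (Z i y) = A i (adjoint T y) := by
    intro i y
    have e := congrArg adjoint (h i)
    rw [adjoint_comp, adjoint_comp, (PosOp.isSelfAdjoint (hA i)).adjoint_eq,
      (PosOp.isSelfAdjoint (hZ i)).adjoint_eq] at e
    exact congrArg (fun f => f y) e
  set U := isometryFlip T
  have hU : star U = U := (isSelfAdjoint_isometryFlip T).star_eq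
  have hUU : U * U = 1 := isometryFlip_mul_self hT
  have hc : ∀ i, star U * dsum (A i) (Z i) * U = dsum (A i) (Z i) := by
    intro i
    have : dsum (A i) (Z i) * U = U * dsum (A i) (Z i) := by
      ext z
      all_goals simp [U, isometryFlip_apply, h', h'']
    rw [hU, mul_assoc, this, ← mul_assoc, hUU, one_mul]
  have key := hF.unitary_conj _ U (Unitary.mem_iff.2 (by rw [hU]; exact ⟨hUU, hUU⟩))
    (fun i => dsum (A i) (Z i)) (fun i => posOp_dsum (hA i) (hZ i))
  simp only [hc] at key
  rw [hF.direct_sum E K A Z hA hZ, hU] at key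
  have key2 : U * dsum (F E A) (F K Z) = dsum (F E A) (F K Z) * U := by
    conv_lhs => rw [key]
    rw [← mul_assoc, ← mul_assoc, hUU, one_mul]
  ext x
  have := congrArg (fun f => (f (WithLp.toLp 2 (x, 0))).snd) key2
  simpa [U, isometryFlip_apply] using this.symm

/-- The operator `T A T† + l (1 - T T†)`, which has `T` as an intertwiner from `A` and which
dominates a given `X` as soon as `T† X T < A` and `l` is large. -/
def dilate (T : E →L[ℂ] K) (A : E →L[ℂ] E) (l : ℝ) : K →L[ℂ] K :=
  T ∘L A ∘L adjoint T + (l : ℂ) • (1 - T ∘L adjoint T)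

theorem isSelfAdjoint_dilate (T : E →L[ℂ] K) {A : E →L[ℂ] E} (hA : IsSelfAdjoint A) (l : ℝ) :
    IsSelfAdjoint (dilate T A l) := by
  rw [IsSelfAdjoint, star_eq_adjoint, dilate]
  simp only [map_add, map_sub, adjoint_comp, hA.adjoint_eq, adjoint_adjoint, comp_assoc,
    map_smulₛₗ, Complex.conj_ofReal]
  rw [← star_eq_adjoint (1 : K →L[ℂ] K), star_one]

theorem dilate_comp {T : E →L[ℂ] K} (hT : adjoint T ∘L T = 1) (A : E →L[ℂ] E) (l : ℝ) :
    dilate T A l ∘L T = T ∘L A := by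
  have h : ∀ x, adjoint T (T x) = x := fun x => congrArg (fun f => f x) hT
  ext x
  simp [dilate, h]

theorem exists_le_dilate {T : E →L[ℂ] K} (hT : adjoint T ∘L T = 1) {A : E →L[ℂ] E}
    (hA : IsSelfAdjoint A) {X : K →L[ℂ] K} (hX : IsSelfAdjoint X) {ε : ℝ} (hε : 0 < ε)
    (h : ∀ x, (⟪T x, X (T x)⟫_ℂ).re + ε * ‖x‖ ^ 2 ≤ (⟪x, A x⟫_ℂ).re) :
    ∃ l : ℝ, X ≤ dilate T A l := by
  have hTT : ∀ x, adjoint T (T x) = x := fun x => congrArg (fun f => f x) hT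
  refine ⟨‖X‖ ^ 2 / ε + ‖X‖, le_of_re_inner_le hX (isSelfAdjoint_dilate T hA _) fun y => ?_⟩
  set a := adjoint T y with ha
  set q := y - T a with hq
  have hy : y = T a + q := by simp [hq]
  have hTq : adjoint T q = 0 := by simp [hq, hTT, ha]
  have hTa : ‖T a‖ = ‖a‖ := by
    have : ⟪T a, T a⟫_ℂ = ⟪a, a⟫_ℂ := by rw [← adjoint_inner_right, hTT]
    rw [inner_self_eq_norm_sq_to_K, inner_self_eq_norm_sq_to_K] at this
    exact (sq_eq_sq₀ (norm_nonneg _) (norm_nonneg _)).1 (by exact_mod_cast this)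
  have h₁ : (⟪y, dilate T A (‖X‖ ^ 2 / ε + ‖X‖) y⟫_ℂ).re =
      (⟪a, A a⟫_ℂ).re + (‖X‖ ^ 2 / ε + ‖X‖) * ‖q‖ ^ 2 := by
    have e : dilate T A (‖X‖ ^ 2 / ε + ‖X‖) y = T (A a) + ((‖X‖ ^ 2 / ε + ‖X‖ : ℝ) : ℂ) • q := by
      simp [dilate, ← ha, hq]
    have e2 : ⟪y, q⟫_ℂ = ⟪q, q⟫_ℂ := by
      conv_lhs => rw [hy]
      rw [inner_add_left, ← adjoint_inner_right, hTq, inner_zero_right, zero_add]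
    rw [e, inner_add_right, ← adjoint_inner_left, ← ha, inner_smul_right, e2,
      inner_self_eq_norm_sq_to_K, Complex.add_re, Complex.re_ofReal_mul]
    norm_cast
  have h₂ : (⟪y, X y⟫_ℂ).re = (⟪T a, X (T a)⟫_ℂ).re + 2 * (⟪T a, X q⟫_ℂ).re
      + (⟪q, X q⟫_ℂ).re := by
    have e : (⟪q, X (T a)⟫_ℂ).re = (⟪T a, X q⟫_ℂ).re := by
      rw [← inner_conj_symm, Complex.conj_re, ← adjoint_inner_right, hX.adjoint_eq]
    conv_lhs => rw [hy]
    simp only [map_add, inner_add_left, inner_add_right, Complex.add_re, e]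
    ring
  have h₃ : (⟪T a, X q⟫_ℂ).re ≤ ‖a‖ * (‖X‖ * ‖q‖) := by
    refine (Complex.re_le_norm _).trans ((norm_inner_le_norm _ _).trans ?_)
    rw [hTa]
    exact mul_le_mul_of_nonneg_left (X.le_opNorm q) (norm_nonneg _)
  have h₄ : (⟪q, X q⟫_ℂ).re ≤ ‖q‖ * (‖X‖ * ‖q‖) := by
    refine (Complex.re_le_norm _).trans ((norm_inner_le_norm _ _).trans ?_)
    exact mul_le_mul_of_nonneg_left (X.le_opNorm q) (norm_nonneg _)
  have h₅ := h a
  have h₆ : 2 * (‖a‖ * (‖X‖ * ‖q‖)) ≤ ε * ‖a‖ ^ 2 + ‖X‖ ^ 2 / ε * ‖q‖ ^ 2 := by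
    have : ε * ‖a‖ ^ 2 + ‖X‖ ^ 2 / ε * ‖q‖ ^ 2 - 2 * (‖a‖ * (‖X‖ * ‖q‖)) =
      (ε * ‖a‖ - ‖X‖ * ‖q‖) ^ 2 / ε := by field_simp; ring
    have : 0 ≤ (ε * ‖a‖ - ‖X‖ * ‖q‖) ^ 2 / ε := by positivity
    linarith
  rw [h₁, h₂]
  linarith

/-- Compression inequality for isometries. -/
theorem compression_le_of_isometry (hF : IsFreeFunction F) (hm : IsOperatorMonotone F)
    {T : E →L[ℂ] K} (hT : adjoint T ∘L T = 1) {A : Fin k → (E →L[ℂ] E)}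
    {X : Fin k → (K →L[ℂ] K)} (hA : ∀ i, A i ∈ PosOp E) (hX : ∀ i, X i ∈ PosOp K)
    {ε : ℝ} (hε : 0 < ε)
    (h : ∀ i x, (⟪T x, X i (T x)⟫_ℂ).re + ε * ‖x‖ ^ 2 ≤ (⟪x, A i x⟫_ℂ).re) (x : E) :
    (⟪T x, F K X (T x)⟫_ℂ).re ≤ (⟪x, F E A x⟫_ℂ).re := by
  choose l hl using fun i => exists_le_dilate hT (PosOp.isSelfAdjoint (hA i))
    (PosOp.isSelfAdjoint (hX i)) hε (h i)
  have hZ : ∀ i, dilate T (A i) (l i) ∈ PosOp K := fun i => PosOp.of_le (hX i) (hl i)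
  have e := hF.intertwine hT hA hZ fun i => dilate_comp hT (A i) (l i)
  refine (re_inner_le_of_le (hm K X _ hX hZ hl) (T x)).trans_eq ?_
  rw [← comp_apply, e, comp_apply, ← adjoint_inner_right, ← comp_apply, hT]
  rfl

/-- Compression inequality for strict contractions, which carries the concavity of operator
monotone functions: the contraction `T` is dilated to the isometry
`x ↦ (T x, (1 - T† T)^{1/2} x)`. -/
theorem compression_le (hF : IsFreeFunction F) (hm : IsOperatorMonotone F)
    {T : E →L[ℂ] K} {A : Fin k → (E →L[ℂ] E)}
    {X : Fin k → (K →L[ℂ] K)} (hA : ∀ i, A i ∈ PosOp E) (hX : ∀ i, X i ∈ PosOp K)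
    {ε : ℝ} (hε : 0 < ε) (hT : ∀ x, ‖T x‖ ^ 2 + ε * ‖x‖ ^ 2 ≤ ‖x‖ ^ 2)
    (h : ∀ i x, (⟪T x, X i (T x)⟫_ℂ).re + ε * ‖x‖ ^ 2 ≤ (⟪x, A i x⟫_ℂ).re) (x : E) :
    (⟪T x, F K X (T x)⟫_ℂ).re ≤ (⟪x, F E A x⟫_ℂ).re := by
  have hDsa : IsSelfAdjoint (1 - adjoint T ∘L T) := by
    rw [IsSelfAdjoint, star_sub, star_one, star_eq_adjoint, adjoint_comp, adjoint_adjoint]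
  have hD : 0 ≤ 1 - adjoint T ∘L T := by
    rw [ContinuousLinearMap.nonneg_iff_isPositive]
    refine isPositive_of_re_inner hDsa fun x => ?_
    have := hT x
    simp only [sub_apply, one_apply_eq_self, comp_apply, inner_sub_right, adjoint_inner_right,
      inner_self_eq_norm_sq_to_K, Complex.sub_re, Complex.coe_algebraMap, ← Complex.ofReal_pow,
      Complex.ofReal_re]
    have : 0 ≤ ε * ‖x‖ ^ 2 := by positivity
    linarith
  set S : E →L[ℂ] E := CFC.sqrt (1 - adjoint T ∘L T) with hS
  have hSS : S * S = 1 - adjoint T ∘L T := CFC.sqrt_mul_sqrt_self _ hD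
  have hSsa : IsSelfAdjoint S := (CFC.sqrt_nonneg _).isSelfAdjoint
  have hSn : ∀ y, ‖T y‖ ^ 2 + ‖S y‖ ^ 2 = ‖y‖ ^ 2 := by
    intro y
    have : ⟪S y, S y⟫_ℂ = ⟪y, y⟫_ℂ - ⟪T y, T y⟫_ℂ := by
      rw [← adjoint_inner_right, hSsa.adjoint_eq, show S (S y) = (S * S) y from rfl, hSS]
      simp [inner_sub_right, adjoint_inner_right]
    simp only [inner_self_eq_norm_sq_to_K] at this
    have h2 : ‖S y‖ ^ 2 = ‖y‖ ^ 2 - ‖T y‖ ^ 2 := by exact_mod_cast this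
    linarith
  let T' : E →L[ℂ] WithLp 2 (K × E) :=
    (WithLp.prodContinuousLinearEquiv 2 ℂ K E).symm.toContinuousLinearMap ∘L T.prod S
  have hT'a : ∀ y, T' y = WithLp.toLp 2 (T y, S y) := fun _ => rfl
  have hT' : adjoint T' ∘L T' = 1 := by
    refine (ContinuousLinearMap.norm_map_iff_adjoint_comp_self T').1 fun y => ?_
    rw [← sq_eq_sq₀ (norm_nonneg _) (norm_nonneg _), WithLp.prod_norm_sq_eq_of_L2, hT'a]
    exact hSn y
  have hε2 : 0 < ε / 2 := by positivity
  have hW : ∀ i : Fin k, ((ε / 2 : ℝ) : ℂ) • (1 : E →L[ℂ] E) ∈ PosOp E :=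
    fun _ => posOp_real_smul_one hε2
  have key := compression_le_of_isometry hF hm hT' hA
    (X := fun i => dsum (X i) (((ε / 2 : ℝ) : ℂ) • 1)) (fun i => posOp_dsum (hX i) (hW i)) hε2
    (fun i y => by
      have h₁ := h i y
      have h₂ := hSn y
      have h₃ : ε / 2 * ‖S y‖ ^ 2 ≤ ε / 2 * ‖y‖ ^ 2 :=
        mul_le_mul_of_nonneg_left (by nlinarith [sq_nonneg ‖T y‖]) hε2.le
      rw [dsum_apply, WithLp.prod_inner_apply, Complex.add_re, hT'a]
      simp only [WithLp.toLp_fst, WithLp.toLp_snd]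
      rw [re_inner_real_smul_one]
      linarith) x
  rw [hF.direct_sum K E _ _ hX hW, dsum_apply, WithLp.prod_inner_apply, Complex.add_re,
    hT'a] at key
  simp only [WithLp.toLp_fst, WithLp.toLp_snd] at key
  have := PosOp.re_inner_nonneg (hF.maps_to E _ hW) (S x)
  linarith

end Free

/-! ### Separation of a point from the matrix convex hypograph -/

section Separation

variable {k : ℕ} {F : GradedFunction.{u} k}
  {E : Type u} [NormedAddCommGroup E] [InnerProductSpace ℂ E]

/-- The open convex cone of all `(M, r)` for which some `T : E → K` and `X ∈ ℙ(K)^k` satisfy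
`T† T < M₀`, `T† Xᵢ T < Mᵢ` and `r < ⟪T v, F(X) T v⟫`. The operator inequalities are strict with a
margin `ε`, and they concern only the real parts of the quadratic forms of the `Mᵢ`, which makes
the cone open in the space of all tuples of operators. -/
def hypographCone (F : GradedFunction.{u} k) (v : E) :
    Set ((Fin (k + 1) → (E →L[ℂ] E)) × ℝ) :=
  {p | ∃ (K : Type u) (_ : NormedAddCommGroup K) (_ : InnerProductSpace ℂ K)
    (_ : CompleteSpace K) (T : E →L[ℂ] K) (X : Fin k → (K →L[ℂ] K)) (ε : ℝ),
    (∀ i, X i ∈ PosOp K) ∧ 0 < ε ∧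
    (∀ x, ‖T x‖ ^ 2 + ε * ‖x‖ ^ 2 ≤ (⟪x, p.1 0 x⟫_ℂ).re) ∧
    (∀ i x, (⟪T x, X i (T x)⟫_ℂ).re + ε * ‖x‖ ^ 2 ≤ (⟪x, p.1 (Fin.succ i) x⟫_ℂ).re) ∧
    p.2 < (⟪T v, F K X (T v)⟫_ℂ).re}

/-- The cone absorbs tuples of operators whose quadratic forms have nonnegative real part. -/
theorem add_nonneg_mem_hypographCone {v : E} {p : (Fin (k + 1) → (E →L[ℂ] E)) × ℝ}
    (hp : p ∈ hypographCone F v) {N : Fin (k + 1) → (E →L[ℂ] E)}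
    (hN : ∀ i x, 0 ≤ (⟪x, N i x⟫_ℂ).re) : p + (N, 0) ∈ hypographCone F v := by
  obtain ⟨K, _, _, _, T, X, ε, hX, hε, h0, hi, hr⟩ := hp
  refine ⟨K, _, _, _, T, X, ε, hX, hε, fun x => ?_, fun i x => ?_, by simpa using hr⟩
  · have := h0 x
    have := hN 0 x
    simp only [Prod.fst_add, Pi.add_apply, add_apply, inner_add_right, Complex.add_re]
    linarith
  · have := hi i x
    have := hN i.succ x
    simp only [Prod.fst_add, Pi.add_apply, add_apply, inner_add_right, Complex.add_re]
    linarith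

theorem re_inner_real_smul {H : Type*} [NormedAddCommGroup H] [InnerProductSpace ℂ H]
    (t : ℝ) (A : H →L[ℂ] H) (x : H) :
    (⟪x, (t • A) x⟫_ℂ).re = t * (⟪x, A x⟫_ℂ).re := by
  rw [smul_apply, ← Complex.coe_smul, inner_smul_right, Complex.re_ofReal_mul]

theorem re_inner_sqrt_smul {H : Type*} [NormedAddCommGroup H] [InnerProductSpace ℂ H]
    {t : ℝ} (ht : 0 ≤ t) (A : H →L[ℂ] H) (x : H) :
    (⟪((√t : ℝ) : ℂ) • x, A (((√t : ℝ) : ℂ) • x)⟫_ℂ).re = t * (⟪x, A x⟫_ℂ).re := by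
  rw [map_smul, inner_smul_right, inner_smul_left, Complex.conj_ofReal, ← mul_assoc,
    ← Complex.ofReal_mul, Real.mul_self_sqrt ht, Complex.re_ofReal_mul]

theorem norm_sqrt_smul_sq {H : Type*} [NormedAddCommGroup H] [InnerProductSpace ℂ H]
    {t : ℝ} (ht : 0 ≤ t) (x : H) : ‖((√t : ℝ) : ℂ) • x‖ ^ 2 = t * ‖x‖ ^ 2 := by
  rw [norm_smul, mul_pow, Complex.norm_real, Real.norm_eq_abs, sq_abs, Real.sq_sqrt ht]

/-- Scaling by `t` amounts to replacing `T` by `√t • T`. -/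
theorem smul_mem_hypographCone {v : E} {p : (Fin (k + 1) → (E →L[ℂ] E)) × ℝ}
    (hp : p ∈ hypographCone F v) {t : ℝ} (ht : 0 < t) : t • p ∈ hypographCone F v := by
  obtain ⟨K, _, _, hK, T, X, ε, hX, hε, h0, hi, hr⟩ := hp
  refine ⟨K, _, _, hK, ((√t : ℝ) : ℂ) • T, X, t * ε, hX, by positivity, fun x => ?_,
    fun i x => ?_, ?_⟩
  · rw [smul_apply, norm_sqrt_smul_sq ht.le, Prod.smul_fst, Pi.smul_apply, re_inner_real_smul]
    have := mul_le_mul_of_nonneg_left (h0 x) ht.le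
    linarith
  · rw [smul_apply, re_inner_sqrt_smul ht.le, Prod.smul_fst, Pi.smul_apply, re_inner_real_smul]
    have := mul_le_mul_of_nonneg_left (hi i x) ht.le
    linarith
  · rw [smul_apply, re_inner_sqrt_smul ht.le, Prod.smul_snd, smul_eq_mul]
    exact mul_lt_mul_of_pos_left hr ht

/-- The sum of two points of the cone is realized on the direct sum of the two spaces. -/
theorem add_mem_hypographCone (hF : IsFreeFunction F) {v : E}
    {p q : (Fin (k + 1) → (E →L[ℂ] E)) × ℝ}
    (hp : p ∈ hypographCone F v) (hq : q ∈ hypographCone F v) :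
    p + q ∈ hypographCone F v := by
  obtain ⟨K, _, _, _, T, X, ε, hX, hε, h0, hi, hr⟩ := hp
  obtain ⟨K', _, _, _, T', X', ε', hX', hε', h0', hi', hr'⟩ := hq
  refine ⟨WithLp 2 (K × K'), inferInstance, inferInstance, inferInstance,
    (WithLp.prodContinuousLinearEquiv 2 ℂ K K').symm.toContinuousLinearMap ∘L T.prod T',
    fun i => dsum (X i) (X' i), ε + ε', fun i => posOp_dsum (hX i) (hX' i), by positivity,
    fun x => ?_, fun i x => ?_, ?_⟩
  · have h₁ := h0 x
    have h₂ := h0' x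
    rw [WithLp.prod_norm_sq_eq_of_L2]
    simp only [Prod.fst_add, Pi.add_apply, add_apply, inner_add_right, Complex.add_re, comp_apply,
      ContinuousLinearEquiv.coe_coe, WithLp.prodContinuousLinearEquiv_symm_apply,
      ContinuousLinearMap.prod_apply, WithLp.toLp_fst, WithLp.toLp_snd]
    linarith
  · have h₁ := hi i x
    have h₂ := hi' i x
    rw [dsum_apply, WithLp.prod_inner_apply]
    simp only [Prod.fst_add, Pi.add_apply, add_apply, inner_add_right, Complex.add_re, comp_apply,
      ContinuousLinearEquiv.coe_coe, WithLp.prodContinuousLinearEquiv_symm_apply,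
      ContinuousLinearMap.prod_apply, WithLp.toLp_fst, WithLp.toLp_snd]
    linarith
  · rw [hF.direct_sum K K' X X' hX hX', dsum_apply, WithLp.prod_inner_apply]
    simp only [Prod.snd_add, Complex.add_re, comp_apply,
      ContinuousLinearEquiv.coe_coe, WithLp.prodContinuousLinearEquiv_symm_apply,
      ContinuousLinearMap.prod_apply, WithLp.toLp_fst, WithLp.toLp_snd]
    linarith

theorem convex_hypographCone (hF : IsFreeFunction F) (v : E) : Convex ℝ (hypographCone F v) :=
  convex_iff_forall_pos.2 fun _ hp _ hq _ _ ha hb _ =>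
    add_mem_hypographCone hF (smul_mem_hypographCone hp ha) (smul_mem_hypographCone hq hb)

theorem re_inner_le_add_of_norm_sub_le {H : Type*} [NormedAddCommGroup H]
    [InnerProductSpace ℂ H] {A B : H →L[ℂ] H} {δ : ℝ} (h : ‖B - A‖ ≤ δ) (x : H) :
    (⟪x, A x⟫_ℂ).re ≤ (⟪x, B x⟫_ℂ).re + δ * ‖x‖ ^ 2 := by
  have h₁ : (⟪x, (A - B) x⟫_ℂ).re ≤ ‖x‖ * (δ * ‖x‖) := by
    refine (Complex.re_le_norm _).trans ((norm_inner_le_norm _ _).trans ?_)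
    refine mul_le_mul_of_nonneg_left (((A - B).le_opNorm x).trans ?_) (norm_nonneg _)
    rw [norm_sub_rev]
    exact mul_le_mul_of_nonneg_right h (norm_nonneg _)
  simp only [sub_apply, inner_sub_right, Complex.sub_re] at h₁
  nlinarith

theorem isOpen_hypographCone (v : E) : IsOpen (hypographCone F v) := by
  rw [Metric.isOpen_iff]
  rintro p ⟨K, _, _, _, T, X, ε, hX, hε, h0, hi, hr⟩
  set s := (⟪T v, F K X (T v)⟫_ℂ).re
  refine ⟨min (ε / 2) (s - p.2), lt_min (by positivity) (by linarith), fun q hq => ?_⟩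
  rw [Metric.mem_ball, dist_eq_norm, lt_min_iff] at hq
  have hM : ∀ i, ‖q.1 i - p.1 i‖ ≤ ε / 2 := fun i =>
    ((norm_le_pi_norm (q.1 - p.1) i).trans (norm_fst_le (q - p))).trans hq.1.le
  have hq2 : q.2 - p.2 < s - p.2 :=
    (le_abs_self _).trans_lt ((norm_snd_le (q - p)).trans_lt hq.2)
  refine ⟨K, _, _, _, T, X, ε / 2, hX, by positivity, fun x => ?_, fun i x => ?_, by linarith⟩
  · have h₁ := h0 x
    have h₂ := re_inner_le_add_of_norm_sub_le (hM 0) x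
    linarith
  · have h₁ := hi i x
    have h₂ := re_inner_le_add_of_norm_sub_le (hM i.succ) x
    linarith

theorem nonpos_of_forall_add_mul_nonpos {a b : ℝ} (h : ∀ δ : ℝ, 0 < δ → a + δ * b ≤ 0) :
    a ≤ 0 := by
  have h' : Filter.Tendsto (fun δ : ℝ => a + δ * b) (nhdsWithin 0 (Set.Ioi 0)) (nhds a) := by
    have : Continuous fun δ : ℝ => a + δ * b := by fun_prop
    simpa using (this.tendsto 0).mono_left nhdsWithin_le_nhds
  exact le_of_tendsto h' (eventually_nhdsWithin_of_forall h)

variable [CompleteSpace E]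

/-- The Hahn–Banach step. The point `(1, A, ⟪v, F(A) v⟫)` lies on the boundary of the open convex
cone `hypographCone F v`; a supporting hyperplane there is not vertical, so it is given by positive
functionals `φ₀, …, φ_k` on operators. -/
theorem exists_supporting_functionals (hF : IsFreeFunction F) (hm : IsOperatorMonotone F)
    {A : Fin k → (E →L[ℂ] E)} (hA : ∀ i, A i ∈ PosOp E) (v : E) :
    ∃ φ : Fin (k + 1) → (E →L[ℂ] E) →ₗ[ℝ] ℝ,
      (∀ i N, (∀ x, 0 ≤ (⟪x, N x⟫_ℂ).re) → 0 ≤ φ i N) ∧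
      (∀ (K : Type u) [NormedAddCommGroup K] [InnerProductSpace ℂ K] [CompleteSpace K]
        (T : E →L[ℂ] K) (X : Fin k → (K →L[ℂ] K)), (∀ i, X i ∈ PosOp K) →
        (⟪T v, F K X (T v)⟫_ℂ).re ≤ φ 0 (adjoint T ∘L T) +
          ∑ i : Fin k, φ i.succ (adjoint T ∘L X i ∘L T)) ∧
      φ 0 1 + ∑ i : Fin k, φ i.succ (A i) = (⟪v, F E A v⟫_ℂ).re := by
  set r₀ := (⟪v, F E A v⟫_ℂ).re with hr₀
  have hr₀n : 0 ≤ r₀ := PosOp.re_inner_nonneg (hF.maps_to E A hA) v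
  set M₀ : Fin (k + 1) → (E →L[ℂ] E) := Fin.cons 1 A with hM₀
  have hone : ∀ x : E, (⟪x, (1 : E →L[ℂ] E) x⟫_ℂ).re = ‖x‖ ^ 2 := fun x => by
    simpa using re_inner_real_smul_one 1 x
  have hnot : (M₀, r₀) ∉ hypographCone F v := by
    rintro ⟨K, _, _, _, T, X, ε, hX, hε, h0, hi, hr⟩
    refine absurd hr (not_lt.2 (compression_le hF hm hA hX hε (fun x => ?_) (fun i x => ?_) v))
    · simpa only [hM₀, Fin.cons_zero, hone] using h0 x
    · simpa [hM₀] using hi i x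
  obtain ⟨f, hf⟩ := geometric_hahn_banach_open_point (convex_hypographCone hF v)
    (isOpen_hypographCone v) hnot
  -- The supporting functional is negative on the cone and vanishes at the boundary point.
  have hle : ∀ q ∈ hypographCone F v, f q ≤ 0 := by
    intro q hq
    by_contra! hpos
    have h₁ := hf _ (smul_mem_hypographCone hq (t := (|f (M₀, r₀)| + 1) / f q) (by positivity))
    rw [map_smul, smul_eq_mul, div_mul_cancel₀ _ hpos.ne'] at h₁
    linarith [le_abs_self (f (M₀, r₀))]
  have hmemδ : ∀ δ : ℝ, 0 < δ →
      (M₀ + fun _ => (δ : ℂ) • (1 : E →L[ℂ] E), r₀ - δ) ∈ hypographCone F v := by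
    intro δ hδ
    refine ⟨E, _, _, inferInstance, 1, A, δ, hA, hδ, fun x => ?_, fun i x => ?_, ?_⟩
    · simp only [hM₀, Pi.add_apply, Fin.cons_zero, add_apply, inner_add_right, Complex.add_re,
        re_inner_real_smul_one, hone]
      simp
    · simp only [hM₀, Pi.add_apply, Fin.cons_succ, add_apply, inner_add_right, Complex.add_re,
        re_inner_real_smul_one, one_apply_eq_self, le_refl]
    · simp only [one_apply_eq_self]
      linarith
  have hf0 : f (M₀, r₀) = 0 := by
    refine le_antisymm ?_ ?_
    · set d : (Fin (k + 1) → (E →L[ℂ] E)) × ℝ := (fun _ => 1, -1)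
      have h₁ : ∀ δ : ℝ, 0 < δ → f (M₀, r₀) + δ * f d ≤ 0 := by
        intro δ hδ
        have h₂ := hle _ (hmemδ δ hδ)
        have e : ((M₀ + fun _ => (δ : ℂ) • (1 : E →L[ℂ] E), r₀ - δ) :
            (Fin (k + 1) → (E →L[ℂ] E)) × ℝ) = (M₀, r₀) + δ • d := by
          refine Prod.ext ?_ ?_
          · funext i
            simp [d, Complex.coe_smul]
          · simp [d, sub_eq_add_neg]
        rwa [e, map_add, map_smul, smul_eq_mul] at h₂
      exact nonpos_of_forall_add_mul_nonpos h₁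
    · by_contra! hneg
      have hq := hmemδ 1 one_pos
      have h₁ := hf _ hq
      have h₂ := hf _ (smul_mem_hypographCone hq
        (t := f (M₀, r₀) / (2 * f _)) (div_pos_of_neg_of_neg hneg
          (mul_neg_of_pos_of_neg two_pos (h₁.trans hneg))))
      rw [map_smul, smul_eq_mul, div_mul_eq_mul_div,
        mul_div_mul_right _ _ (h₁.trans hneg).ne] at h₂
      linarith
  -- The zero map `T` shows that points over `(1, A)` with negative last coordinate lie in the
  -- cone, so the hyperplane is not vertical.
  have hmem : (M₀, (-1 : ℝ)) ∈ hypographCone F v := by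
    choose a ha hAa using fun i => PosOp.exists_le (hA i)
    obtain ⟨ε, hε, hε1, hεa⟩ : ∃ ε : ℝ, 0 < ε ∧ ε ≤ 1 ∧ ∀ i, ε ≤ a i := by
      obtain ⟨j, hj⟩ := Finite.exists_min (Fin.cons 1 a : Fin (k + 1) → ℝ)
      refine ⟨_, ?_, hj 0, fun i => hj i.succ⟩
      refine Fin.cases ?_ (fun i => ?_) j
      · exact one_pos
      · exact ha i
    refine ⟨E, _, _, inferInstance, 0, A, ε, hA, hε, fun x => ?_, fun i x => ?_, by simp⟩
    · simp only [hM₀, Fin.cons_zero, hone, zero_apply, norm_zero]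
      nlinarith [sq_nonneg ‖x‖]
    · have := hAa i x
      simp only [hM₀, Fin.cons_succ, zero_apply, inner_zero_left, Complex.zero_re, zero_add]
      exact (mul_le_mul_of_nonneg_right (hεa i) (sq_nonneg _)).trans this
  set c := f (0, 1) with hc
  have hfr : ∀ (M : Fin (k + 1) → (E →L[ℂ] E)) (r : ℝ), f (M, r) = f (M, 0) + r * c := by
    intro M r
    rw [hc, ← smul_eq_mul, ← map_smul, ← map_add]
    simp
  have hcpos : 0 < c := by
    have h₁ := hf _ hmem
    rw [hfr, hfr M₀ r₀] at h₁
    nlinarith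
  have hsum : ∀ M : Fin (k + 1) → (E →L[ℂ] E), f (M, 0) = ∑ i, f (Pi.single i (M i), 0) := by
    intro M
    conv_lhs => rw [show ((M, 0) : (Fin (k + 1) → (E →L[ℂ] E)) × ℝ) =
      LinearMap.inl ℝ (Fin (k + 1) → (E →L[ℂ] E)) ℝ M from rfl,
      ← Finset.univ_sum_single M, map_sum, map_sum]
    rfl
  let φ : Fin (k + 1) → (E →L[ℂ] E) →ₗ[ℝ] ℝ := fun i =>
    (-c⁻¹) • (f.toLinearMap ∘ₗ LinearMap.inl ℝ (Fin (k + 1) → (E →L[ℂ] E)) ℝ ∘ₗ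
      LinearMap.single ℝ (fun _ => E →L[ℂ] E) i)
  have hφ : ∀ i N, φ i N = -c⁻¹ * f (Pi.single i N, 0) := fun i N => rfl
  have hφsum : ∀ M : Fin (k + 1) → (E →L[ℂ] E), ∑ i, φ i (M i) = -c⁻¹ * f (M, 0) := by
    intro M
    rw [hsum, Finset.mul_sum]
    exact Finset.sum_congr rfl fun i _ => hφ i (M i)
  refine ⟨φ, fun i N hN => ?_, fun K _ _ _ T X hX => ?_, ?_⟩
  · have h₁ : f (Pi.single i N, 0) ≤ 0 := by
      by_contra! hpos
      set t := (|f (M₀, -1)| + 1) / f (Pi.single i N, 0) with ht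
      have htp : 0 < t := by positivity
      have h₂ := hle _ (add_nonneg_mem_hypographCone hmem (N := t • Pi.single i N) fun j x => by
        rw [Pi.smul_apply, re_inner_real_smul]
        refine mul_nonneg htp.le ?_
        by_cases hj : j = i
        · subst hj
          simpa using hN x
        · simp [Pi.single_eq_of_ne hj])
      have e : f (t • Pi.single i N, 0) = t * f (Pi.single i N, 0) := by
        rw [← smul_eq_mul, ← map_smul, Prod.smul_mk, smul_zero]
      rw [map_add, e, ht, div_mul_cancel₀ _ hpos.ne'] at h₂
      linarith [neg_abs_le (f (M₀, -1))]
    rw [hφ]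
    have : 0 < c⁻¹ := by positivity
    nlinarith
  · set s := (⟪T v, F K X (T v)⟫_ℂ).re with hs
    set M : Fin (k + 1) → (E →L[ℂ] E) :=
      Fin.cons (adjoint T ∘L T) fun i => adjoint T ∘L X i ∘L T with hM
    set d : (Fin (k + 1) → (E →L[ℂ] E)) × ℝ := (fun _ => 1, -1)
    have h₁ : ∀ δ : ℝ, 0 < δ → f (M, s) + δ * f d ≤ 0 := by
      intro δ hδ
      have hmem' : (M, s) + δ • d ∈ hypographCone F v := by
        refine ⟨K, _, _, inferInstance, T, X, δ, hX, hδ, fun x => ?_, fun i x => ?_, ?_⟩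
        · simp only [d, hM, Prod.fst_add, Prod.smul_fst, Pi.add_apply, Pi.smul_apply,
            Fin.cons_zero, add_apply, inner_add_right, Complex.add_re, re_inner_real_smul, hone,
            comp_apply, adjoint_inner_right, inner_self_eq_norm_sq_to_K]
          norm_cast
        · simp only [d, hM, Prod.fst_add, Prod.smul_fst, Pi.add_apply, Pi.smul_apply,
            Fin.cons_succ, add_apply, inner_add_right, Complex.add_re, re_inner_real_smul, hone,
            comp_apply, adjoint_inner_right, le_refl]
        · simp only [d, Prod.snd_add, Prod.smul_snd, smul_eq_mul]
          linarith
      have h₂ := hle _ hmem'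
      rwa [map_add, map_smul, smul_eq_mul] at h₂
    have h₂ : f (M, s) ≤ 0 := nonpos_of_forall_add_mul_nonpos h₁
    have h₃ := hφsum M
    rw [Fin.sum_univ_succ] at h₃
    simp only [hM, Fin.cons_zero, Fin.cons_succ] at h₃
    rw [h₃, ← hM]
    rw [hfr] at h₂
    have : c⁻¹ * (f (M, 0) + s * c) ≤ 0 := by
      have : 0 < c⁻¹ := by positivity
      nlinarith
    have e : c⁻¹ * (f (M, 0) + s * c) = c⁻¹ * f (M, 0) + s := by field_simp
    linarith
  · have h₃ := hφsum M₀
    rw [Fin.sum_univ_succ] at h₃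
    simp only [hM₀, Fin.cons_zero, Fin.cons_succ] at h₃
    rw [h₃, ← hM₀]
    rw [hfr] at hf0
    have e : f (M₀, 0) = -(r₀ * c) := by linarith
    rw [e]
    field_simp

end Separation

/-! ### Operators on the dual of `ℂⁿ` and functionals on the operators of `ℂⁿ` -/

section Tensor

variable {n : ℕ} {K : Type*} [NormedAddCommGroup K] [InnerProductSpace ℂ K]

theorem isPositive_of_inner_nonneg {A : K →L[ℂ] K} (h : ∀ x, 0 ≤ ⟪x, A x⟫_ℂ) : A.IsPositive := by
  refine (isPositive_iff_complex A).2 fun x => ?_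
  have h' : 0 ≤ ⟪A x, x⟫_ℂ := by
    rw [← inner_conj_symm]
    exact star_nonneg_iff.2 (h x)
  obtain ⟨h₁, h₂⟩ := Complex.le_def.1 h'
  exact ⟨Complex.ext (by simp) (by simpa using h₂), h₁⟩

theorem inner_single_single (a b : ULift.{u} (Fin n)) :
    ⟪(EuclideanSpace.single a (1 : ℂ) : Coord.{u} n), EuclideanSpace.single b 1⟫_ℂ =
      if a = b then 1 else 0 := by
  simp [EuclideanSpace.inner_single_left]

theorem sum_smul_single (x : Coord.{u} n) :
    ∑ a, x a • (EuclideanSpace.single a (1 : ℂ) : Coord.{u} n) = x := by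
  simpa using (EuclideanSpace.basisFun (ULift.{u} (Fin n)) ℂ).sum_repr x

theorem sum_inner_smul_rankOne (M : Coord.{u} n →L[ℂ] Coord.{u} n) :
    ∑ a, ∑ b, ⟪(EuclideanSpace.single a (1 : ℂ) : Coord.{u} n), M (EuclideanSpace.single b 1)⟫_ℂ •
      InnerProductSpace.rankOne ℂ (EuclideanSpace.single a (1 : ℂ) : Coord.{u} n)
        (EuclideanSpace.single b (1 : ℂ) : Coord.{u} n) = M := by
  refine ContinuousLinearMap.ext fun x => ?_
  conv_rhs => rw [← sum_smul_single x, map_sum, ← sum_smul_single (∑ b, M _)]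
  simp only [sum_apply, smul_apply, InnerProductSpace.rankOne_apply, map_smul,
    EuclideanSpace.inner_single_left, map_one, one_mul, smul_smul, ← Finset.sum_smul]
  simp [mul_comm]

/-- The vector `∑ eₐ* ⊗ T eₐ` of `(ℂⁿ)* ⊗ K` representing the operator `T : ℂⁿ → K`. -/
def tensorOfMap (T : Coord.{u} n →L[ℂ] K) : Coord.{u} n ⊗[ℂ] K :=
  ∑ a : ULift.{u} (Fin n), EuclideanSpace.single a (1 : ℂ) ⊗ₜ[ℂ] T (EuclideanSpace.single a 1)

theorem tensorOfMap_rankOne (x : Coord.{u} n) (y : K) :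
    tensorOfMap (InnerProductSpace.rankOne ℂ y (dualVec x)) = x ⊗ₜ[ℂ] y := by
  conv_rhs => rw [← sum_smul_single x, TensorProduct.sum_tmul]
  refine Finset.sum_congr rfl fun a _ => ?_
  rw [InnerProductSpace.rankOne_apply, EuclideanSpace.inner_single_right, TensorProduct.tmul_smul,
    TensorProduct.smul_tmul']
  simp [dualVec]

theorem exists_tensorOfMap (ξ : Coord.{u} n ⊗[ℂ] K) : ∃ T, tensorOfMap T = ξ := by
  induction ξ using TensorProduct.induction_on with
  | zero => exact ⟨0, by simp [tensorOfMap]⟩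
  | tmul x y => exact ⟨_, tensorOfMap_rankOne x y⟩
  | add x y hx hy =>
    obtain ⟨S, rfl⟩ := hx
    obtain ⟨T, rfl⟩ := hy
    exact ⟨S + T, by simp [tensorOfMap, TensorProduct.tmul_add, Finset.sum_add_distrib]⟩

theorem inner_mapL_tensorOfMap (B : Coord.{u} n →L[ℂ] Coord.{u} n) (Z : K →L[ℂ] K)
    (T : Coord.{u} n →L[ℂ] K) :
    ⟪tensorOfMap T, TensorProduct.mapL B Z (tensorOfMap T)⟫_ℂ =
      ∑ a, ∑ b, ⟪(EuclideanSpace.single a (1 : ℂ) : Coord.{u} n), B (EuclideanSpace.single b 1)⟫_ℂ *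
        ⟪T (EuclideanSpace.single a 1), Z (T (EuclideanSpace.single b 1))⟫_ℂ := by
  simp only [tensorOfMap, map_sum, TensorProduct.mapL_tmul, sum_inner, inner_sum,
    TensorProduct.inner_tmul]
  exact Finset.sum_comm

/-- The operator on `(ℂⁿ)*` whose matrix is given by the values of a functional `g` at the matrix
units. -/
def opOfFunctional (g : (Coord.{u} n →L[ℂ] Coord.{u} n) →ₗ[ℂ] ℂ) :
    Coord.{u} n →L[ℂ] Coord.{u} n :=
  ∑ a, ∑ b, g (InnerProductSpace.rankOne ℂ (EuclideanSpace.single a 1)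
      (EuclideanSpace.single b 1)) •
    InnerProductSpace.rankOne ℂ (EuclideanSpace.single a 1) (EuclideanSpace.single b 1)

theorem inner_opOfFunctional (g : (Coord.{u} n →L[ℂ] Coord.{u} n) →ₗ[ℂ] ℂ)
    (a b : ULift.{u} (Fin n)) :
    ⟪(EuclideanSpace.single a (1 : ℂ) : Coord.{u} n),
      opOfFunctional g (EuclideanSpace.single b 1)⟫_ℂ =
      g (InnerProductSpace.rankOne ℂ (EuclideanSpace.single a 1)
        (EuclideanSpace.single b 1)) := by
  simp only [opOfFunctional, sum_apply, smul_apply, InnerProductSpace.rankOne_apply, inner_sum,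
    inner_smul_right, inner_single_single]
  simp

theorem opOfFunctional_inner (v : Coord.{u} n) :
    opOfFunctional ((innerSL ℂ v).toLinearMap ∘ₗ
      (ContinuousLinearMap.apply ℂ (Coord.{u} n) v).toLinearMap) = dualProj v := by
  rw [← sum_inner_smul_rankOne (dualProj v)]
  refine Finset.sum_congr rfl fun a _ => Finset.sum_congr rfl fun b _ => congrArg₂ _ ?_ rfl
  simp [dualProj, dualVec, EuclideanSpace.inner_single_left, EuclideanSpace.inner_single_right,
    inner_smul_right]

variable [CompleteSpace K]

theorem inner_opOfFunctional_tensorOfMap (g : (Coord.{u} n →L[ℂ] Coord.{u} n) →ₗ[ℂ] ℂ)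
    (Z : K →L[ℂ] K) (T : Coord.{u} n →L[ℂ] K) :
    ⟪tensorOfMap T, TensorProduct.mapL (opOfFunctional g) Z (tensorOfMap T)⟫_ℂ =
      g (adjoint T ∘L Z ∘L T) := by
  rw [inner_mapL_tensorOfMap, ← sum_inner_smul_rankOne (adjoint T ∘L Z ∘L T)]
  simp only [map_sum, map_smul, smul_eq_mul, inner_opOfFunctional, comp_apply, adjoint_inner_right]
  exact Finset.sum_congr rfl fun a _ => Finset.sum_congr rfl fun b _ => mul_comm _ _

theorem isPositive_opOfFunctional {g : (Coord.{u} n →L[ℂ] Coord.{u} n) →ₗ[ℂ] ℂ}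
    (hg : ∀ N : Coord.{u} n →L[ℂ] Coord.{u} n, N.IsPositive → 0 ≤ g N) :
    (opOfFunctional g).IsPositive := by
  refine isPositive_of_inner_nonneg fun x => ?_
  have h := inner_opOfFunctional_tensorOfMap g (1 : ℂ →L[ℂ] ℂ)
    (InnerProductSpace.rankOne ℂ (1 : ℂ) (dualVec x))
  rw [tensorOfMap_rankOne, TensorProduct.mapL_tmul, TensorProduct.inner_tmul] at h
  rw [show ⟪x, opOfFunctional g x⟫_ℂ = ⟪x, opOfFunctional g x⟫_ℂ *
    ⟪(1 : ℂ), (1 : ℂ →L[ℂ] ℂ) 1⟫_ℂ by simp, h]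
  exact hg _ (isPositive_adjoint_comp_self _)

theorem trace_opOfFunctional (g : (Coord.{u} n →L[ℂ] Coord.{u} n) →ₗ[ℂ] ℂ) :
    LinearMap.trace ℂ (Coord.{u} n) (opOfFunctional g).toLinearMap = g 1 := by
  rw [LinearMap.trace_eq_sum_inner _ (EuclideanSpace.basisFun (ULift.{u} (Fin n)) ℂ),
    ← sum_inner_smul_rankOne (1 : Coord.{u} n →L[ℂ] Coord.{u} n)]
  simp only [EuclideanSpace.basisFun_apply, ContinuousLinearMap.coe_coe, inner_opOfFunctional,
    one_apply_eq_self, inner_single_single, map_sum, map_smul, smul_eq_mul, ite_mul, one_mul,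
    zero_mul, Finset.sum_ite_eq, Finset.mem_univ, if_true]

/-- A real functional that is nonnegative on all operators whose quadratic form has nonnegative
real part is the restriction of a complex positive functional. -/
theorem exists_complex_functional {E : Type*} [NormedAddCommGroup E] [InnerProductSpace ℂ E]
    [CompleteSpace E] {φ : (E →L[ℂ] E) →ₗ[ℝ] ℝ}
    (hφ : ∀ N, (∀ x, 0 ≤ (⟪x, N x⟫_ℂ).re) → 0 ≤ φ N) :
    ∃ g : (E →L[ℂ] E) →ₗ[ℂ] ℂ, ∀ N, IsSelfAdjoint N → g N = φ N := by
  refine ⟨Module.Dual.extendRCLike (𝕜 := ℂ) φ, fun N hN => ?_⟩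
  have h : ∀ x, (⟪x, (Complex.I • N) x⟫_ℂ).re = 0 := by
    intro x
    have : (⟪x, N x⟫_ℂ).im = 0 := by
      rw [← Complex.conj_eq_iff_im, inner_conj_symm, ← adjoint_inner_right, hN.adjoint_eq]
    simp [this]
  have h₁ := hφ (Complex.I • N) fun x => (h x).ge
  have h₂ := hφ (-(Complex.I • N)) fun x => by
    rw [neg_apply, inner_neg_right, Complex.neg_re, h x, neg_zero]
  rw [map_neg] at h₂
  have h₃ : φ (Complex.I • N) = 0 := by linarith
  simp [Module.Dual.extendRCLike_apply, h₃]

end Tensor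

/-! ### Existence of supporting pencils -/

section Existence

variable {k : ℕ} {F : GradedFunction.{u} k}

theorem pencil_cons_eq {V K : Type*} [NormedAddCommGroup V] [InnerProductSpace ℂ V]
    [NormedAddCommGroup K] [InnerProductSpace ℂ K] (G : Fin (k + 1) → (V →L[ℂ] V))
    (X : Fin k → (K →L[ℂ] K)) :
    pencil (Fin.cons (∑ i, G i) fun i => G i.succ) X =
      TensorProduct.mapL (G 0) 1 + ∑ i : Fin k, TensorProduct.mapL (G i.succ) (X i) := by
  have hs : TensorProduct.mapL (∑ i : Fin k, G i.succ) (1 : K →L[ℂ] K) =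
      ∑ i : Fin k, TensorProduct.mapL (G i.succ) (1 : K →L[ℂ] K) := by
    ext z
    induction z using TensorProduct.induction_on with
    | zero => simp
    | tmul x y => simp [TensorProduct.sum_tmul]
    | add x y hx hy => rw [map_add, map_add, hx, hy]
  have hX : ∀ i, TensorProduct.mapL (G i.succ) (X i) =
      TensorProduct.mapL (G i.succ) (1 : K →L[ℂ] K) + TensorProduct.mapL (G i.succ) (X i - 1) := by
    intro i
    rw [← TensorProduct.mapL_add_right, add_sub_cancel]
  rw [pencil, Fin.cons_zero, Fin.sum_univ_succ, TensorProduct.mapL_add_left, hs]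
  simp only [Fin.cons_succ, hX, Finset.sum_add_distrib, add_assoc]

/-- A scalar point is a direct sum of one-dimensional scalar points, so `F` maps it to the scalar
`F(c, …, c)`. -/
theorem re_inner_apply_scalar_le (hF : IsFreeFunction F) {c : ℝ} (hc : 0 < c) {n : ℕ}
    {v : Coord.{u} n} (hv : ‖v‖ = 1) :
    (⟪v, F (Coord.{u} n) (fun _ => (c : ℂ) • 1) v⟫_ℂ).re ≤
      ‖F (Coord.{u} 1) (fun _ => (c : ℂ) • 1)‖ := by
  set e : Coord.{u} 1 := EuclideanSpace.single ⟨0⟩ 1 with he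
  have hen : ‖e‖ = 1 := by simp [he]
  set T : Coord.{u} 1 →L[ℂ] Coord.{u} n := InnerProductSpace.rankOne ℂ v e with hT
  have hTe : T e = v := by
    simp [hT, InnerProductSpace.rankOne_apply, inner_self_eq_norm_sq_to_K, hen]
  have hTT : adjoint T ∘L T = 1 := by
    refine (ContinuousLinearMap.norm_map_iff_adjoint_comp_self T).1 fun y => ?_
    have hy : y = y ⟨0⟩ • e := by
      conv_lhs => rw [← sum_smul_single y]
      exact Fintype.sum_unique _
    rw [hy, map_smul, norm_smul, norm_smul, hTe, hen, hv]
  have key := hF.intertwine hTT (A := fun _ => (c : ℂ) • 1) (Z := fun _ => (c : ℂ) • 1)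
    (fun _ => posOp_real_smul_one hc) (fun _ => posOp_real_smul_one hc) (fun _ => by ext; simp)
  have h₂ := congrArg (fun f => ⟪T e, f e⟫_ℂ) key
  simp only [comp_apply] at h₂
  rw [← adjoint_inner_right T e (T _), ← comp_apply (adjoint T) T, hTT, hTe,
    one_apply_eq_self] at h₂
  rw [h₂]
  refine (Complex.re_le_norm _).trans ((norm_inner_le_norm _ _).trans ?_)
  rw [hen, one_mul]
  refine (le_opNorm _ _).trans_eq ?_
  rw [hen, mul_one]

/-- Supporting pencils exist: `B₁, …, B_k` are the operators of the separating functionals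
`φ₁, …, φ_k`, and `B₀ = G₀ + B₁ + ⋯ + B_k` where `G₀` is the operator of `φ₀`. The vectors of
`(ℂⁿ)* ⊗ K` are the operators `T : ℂⁿ → K`, on which the quadratic form of the pencil is
`φ₀(T† T) + ∑ φᵢ(T† Xᵢ T) - ⟪T v, Y T v⟫`. -/
theorem exists_supportingPencil (hF : IsFreeFunction F) (hm : IsOperatorMonotone F)
    {c₁ c₂ : ℝ} (hc₁ : 0 < c₁) (hc₂ : c₁ < c₂) {n : ℕ}
    {A : Fin k → (Coord.{u} n →L[ℂ] Coord.{u} n)} {v : Coord.{u} n}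
    (hA : ∀ i, A i ∈ PosOpIcc c₁ c₂ (Coord.{u} n)) (hv : ‖v‖ = 1) :
    ∃ B, IsSupportingPencil F c₁ c₂ A v B := by
  have hA' : ∀ i, A i ∈ PosOp (Coord.{u} n) := fun i => (hA i).1
  obtain ⟨φ, hφ, hsup, hφA⟩ := exists_supporting_functionals hF hm hA' v
  choose g hg using fun i => exists_complex_functional (hφ i)
  have hgpos : ∀ i (N : Coord.{u} n →L[ℂ] Coord.{u} n), N.IsPositive → 0 ≤ g i N := by
    intro i N hN
    rw [hg i N hN.isSelfAdjoint]
    exact_mod_cast hφ i N hN.re_inner_nonneg_right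
  have hP : ∀ i, (opOfFunctional (g i)).IsPositive := fun i => isPositive_opOfFunctional (hgpos i)
  have hinner : ∀ (K : Type u) [NormedAddCommGroup K] [InnerProductSpace ℂ K] [CompleteSpace K]
      (Y : K →L[ℂ] K) (X : Fin k → (K →L[ℂ] K)) (T : Coord.{u} n →L[ℂ] K),
      (∀ i, IsSelfAdjoint (X i)) →
      ⟪tensorOfMap T, (pencil (Fin.cons (∑ i, opOfFunctional (g i))
        fun i : Fin k => opOfFunctional (g i.succ)) X - TensorProduct.mapL (dualProj v) Y)
        (tensorOfMap T)⟫_ℂ = ((φ 0 (adjoint T ∘L T) +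
          ∑ i : Fin k, φ i.succ (adjoint T ∘L X i ∘L T) : ℝ) : ℂ) - ⟪T v, Y (T v)⟫_ℂ := by
    intro K _ _ _ Y X T hX
    rw [pencil_cons_eq (fun i => opOfFunctional (g i)), ← opOfFunctional_inner v]
    simp only [sub_apply, add_apply, sum_apply, inner_sub_right, inner_add_right, inner_sum,
      inner_opOfFunctional_tensorOfMap]
    have h1 : adjoint T ∘L (1 : K →L[ℂ] K) ∘L T = adjoint T ∘L T := rfl
    rw [h1, hg 0 _ (isPositive_adjoint_comp_self T).isSelfAdjoint, Finset.sum_congr rfl fun i _ =>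
      hg i.succ (adjoint T ∘L X i ∘L T) ((hX i).adjoint_conj T)]
    simp [adjoint_inner_right]
  refine ⟨Fin.cons (∑ i, opOfFunctional (g i)) fun i => opOfFunctional (g i.succ), ?_, ?_, ?_, ?_,
    ?_⟩
  · refine Fin.cases ?_ fun i => ?_
    · simpa using isPositive_sum _ fun i _ => hP i
    · simpa using hP i.succ
  · simp only [Fin.cons_succ, Fin.cons_zero]
    rw [Fin.sum_univ_succ, ContinuousLinearMap.le_def]
    simpa using hP 0
  · rintro K _ _ _ Y X ⟨hY, hX, hYX⟩
    refine isPositive_of_inner_nonneg fun ξ => ?_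
    obtain ⟨T, rfl⟩ := exists_tensorOfMap ξ
    rw [hinner K Y X T fun i => PosOp.isSelfAdjoint (hX i)]
    have h₁ := hsup K T X hX
    have h₂ := re_inner_le_of_le hYX (T v)
    have h₃ : ⟪T v, Y (T v)⟫_ℂ = ((⟪T v, Y (T v)⟫_ℂ).re : ℂ) := by
      rw [eq_comm, ← Complex.conj_eq_iff_re, inner_conj_symm, ← adjoint_inner_right, hY.adjoint_eq]
    simp only at h₂
    rw [h₃, ← Complex.ofReal_sub]
    exact_mod_cast sub_nonneg.2 (h₂.trans h₁)
  · have e : canonicalVec.{u} n = tensorOfMap (1 : Coord.{u} n →L[ℂ] Coord.{u} n) := rfl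
    have h₃ : ⟪v, F (Coord.{u} n) A v⟫_ℂ = ((⟪v, F (Coord.{u} n) A v⟫_ℂ).re : ℂ) := by
      rw [eq_comm, ← Complex.conj_eq_iff_re, inner_conj_symm, ← adjoint_inner_right,
        (PosOp.isSelfAdjoint (hF.maps_to _ _ hA')).adjoint_eq]
    have e1 : adjoint (1 : Coord.{u} n →L[ℂ] Coord.{u} n) = 1 := by
      rw [← star_eq_adjoint, star_one]
    rw [e, hinner _ _ A 1 fun i => PosOp.isSelfAdjoint (hA' i), one_apply_eq_self, h₃, ← hφA, e1]
    exact sub_self _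
  · rw [Fin.cons_zero, show (∑ i, opOfFunctional (g i)).toLinearMap =
      ∑ i, (opOfFunctional (g i)).toLinearMap by ext; simp, map_sum]
    simp only [trace_opOfFunctional]
    rw [Finset.sum_congr rfl fun i _ => hg i 1 (.one _), ← Complex.ofReal_sum, Complex.ofReal_re,
      le_div_iff₀ (lt_min one_pos hc₁), Fin.sum_univ_succ]
    have hφ1 : ∀ i, 0 ≤ φ i 1 := fun i =>
      hφ i 1 (isPositive_one (𝕜 := ℂ) (E := Coord.{u} n)).re_inner_nonneg_right
    have hφc : ∀ i : Fin k, c₁ * φ i.succ 1 ≤ φ i.succ (A i) := by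
      intro i
      have := hφ i.succ (A i - (c₁ : ℂ) • 1)
        ((ContinuousLinearMap.le_def _ _).1 (hA i).2.1).re_inner_nonneg_right
      rw [map_sub, Complex.coe_smul, map_smul, smul_eq_mul] at this
      linarith
    have hle : F (Coord.{u} n) A ≤ F (Coord.{u} n) (fun _ => (c₂ : ℂ) • 1) :=
      hm _ A _ hA' (fun _ => posOp_real_smul_one (hc₁.trans hc₂)) fun i => (hA i).2.2
    calc (φ 0 1 + ∑ i : Fin k, φ i.succ 1) * min 1 c₁
        = φ 0 1 * min 1 c₁ + ∑ i : Fin k, min 1 c₁ * φ i.succ 1 := by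
          rw [← Finset.mul_sum]; ring
      _ ≤ φ 0 1 + ∑ i : Fin k, φ i.succ (A i) := by
          refine add_le_add (mul_le_of_le_one_right (hφ1 0) (min_le_left _ _))
            (Finset.sum_le_sum fun i _ => le_trans ?_ (hφc i))
          exact mul_le_mul_of_nonneg_right (min_le_right _ _) (hφ1 _)
      _ = (⟪v, F (Coord.{u} n) A v⟫_ℂ).re := hφA
      _ ≤ _ := (re_inner_le_of_le hle v).trans (re_inner_apply_scalar_le hF (hc₁.trans hc₂) hv)

end Existence

/-! ### Functional calculus and Schur complements in finite dimension -/

section FunctionalCalculus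

variable {V : Type*} [NormedAddCommGroup V] [InnerProductSpace ℂ V] [CompleteSpace V]

theorem isSelfAdjoint_genInv (D : V →L[ℂ] V) : IsSelfAdjoint (genInv D) := cfc_predicate _ _

/-- The square root of a positive operator. -/
def sqrtOp (D : V →L[ℂ] V) : V →L[ℂ] V := cfc (fun x : ℝ => √x) D

/-- The square root of the generalized inverse of a positive operator. -/
def sqrtInvOp (D : V →L[ℂ] V) : V →L[ℂ] V := cfc (fun x : ℝ => (√x)⁻¹) D

theorem isSelfAdjoint_sqrtOp (D : V →L[ℂ] V) : IsSelfAdjoint (sqrtOp D) := cfc_predicate _ _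

theorem isSelfAdjoint_sqrtInvOp (D : V →L[ℂ] V) : IsSelfAdjoint (sqrtInvOp D) :=
  cfc_predicate _ _

theorem sqrtOp_nonneg (D : V →L[ℂ] V) : 0 ≤ sqrtOp D := cfc_nonneg fun _ _ => Real.sqrt_nonneg _

variable [FiniteDimensional ℂ V]

/-- In finite dimension the spectrum is finite, so the functional calculus applies to arbitrary
functions. -/
theorem continuousOn_spectrum (D : V →L[ℂ] V) (f : ℝ → ℝ) : ContinuousOn f (spectrum ℝ D) := by
  have h : (spectrum ℂ D).Finite := by
    rw [ContinuousLinearMap.spectrum_eq]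
    exact Module.End.finite_spectrum D.toLinearMap
  have h' : (spectrum ℝ D).Finite := by
    rw [← spectrum.preimage_algebraMap ℂ]
    exact h.preimage (FaithfulSMul.algebraMap_injective ℝ ℂ).injOn
  exact h'.continuousOn f

variable {D : V →L[ℂ] V}

theorem cfc_mul_cfc (D : V →L[ℂ] V) (f g : ℝ → ℝ) :
    cfc f D * cfc g D = cfc (fun x => f x * g x) D :=
  (cfc_mul f g D (continuousOn_spectrum D f) (continuousOn_spectrum D g)).symm

theorem mul_genInv (hD : IsSelfAdjoint D) : D * genInv D = cfc (fun x : ℝ => x * x⁻¹) D := by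
  rw [genInv]
  nth_rewrite 1 [← cfc_id ℝ D]
  rw [cfc_mul_cfc]
  rfl

theorem genInv_mul (hD : IsSelfAdjoint D) : genInv D * D = cfc (fun x : ℝ => x * x⁻¹) D := by
  nth_rewrite 2 [← cfc_id ℝ D]
  rw [genInv, cfc_mul_cfc]
  exact congrArg (fun f => cfc f D) (funext fun x => mul_comm _ _)

theorem genInv_comm (hD : IsSelfAdjoint D) : genInv D * D = D * genInv D := by
  rw [genInv_mul hD, mul_genInv hD]

theorem mul_genInv_mul (hD : IsSelfAdjoint D) : D * genInv D * D = D := by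
  rw [mul_genInv hD]
  nth_rewrite 2 [← cfc_id ℝ D]
  rw [cfc_mul_cfc]
  conv_rhs => rw [← cfc_id ℝ D]
  exact congrArg (fun f => cfc f D) (funext fun x => by simp)

theorem mul_genInv_genInv (hD : IsSelfAdjoint D) : D * genInv D * genInv D = genInv D := by
  rw [mul_genInv hD, genInv, cfc_mul_cfc]
  refine congrArg (fun f => cfc f D) (funext fun x => ?_)
  by_cases hx : x = 0 <;> simp [hx]

theorem sqrtOp_mul_sqrtOp (hD : 0 ≤ D) : sqrtOp D * sqrtOp D = D := by
  rw [sqrtOp, cfc_mul_cfc]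
  conv_rhs => rw [← cfc_id ℝ D]
  exact cfc_congr fun x hx => Real.mul_self_sqrt (spectrum_nonneg_of_nonneg hD hx)

theorem sqrtInvOp_mul_sqrtInvOp (hD : 0 ≤ D) : sqrtInvOp D * sqrtInvOp D = genInv D := by
  rw [sqrtInvOp, cfc_mul_cfc, genInv]
  refine cfc_congr fun x hx => ?_
  rw [← mul_inv, Real.mul_self_sqrt (spectrum_nonneg_of_nonneg hD hx)]

theorem sqrtOp_mul_sqrtInvOp (hD : 0 ≤ D) : sqrtOp D * sqrtInvOp D = D * genInv D := by
  rw [mul_genInv hD.isSelfAdjoint, sqrtOp, sqrtInvOp, cfc_mul_cfc]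
  refine cfc_congr fun x hx => ?_
  have hx' : 0 ≤ x := spectrum_nonneg_of_nonneg hD hx
  by_cases h : x = 0
  · simp [h]
  · have : √x ≠ 0 := (Real.sqrt_pos.2 (lt_of_le_of_ne hx' (Ne.symm h))).ne'
    rw [mul_inv_cancel₀ this, mul_inv_cancel₀ h]

theorem sqrtInvOp_mul_sqrtOp (hD : 0 ≤ D) : sqrtInvOp D * sqrtOp D = genInv D * D := by
  have := congrArg star (sqrtOp_mul_sqrtInvOp hD)
  rwa [star_mul, star_mul, (isSelfAdjoint_sqrtInvOp D).star_eq, (isSelfAdjoint_sqrtOp D).star_eq,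
    (isSelfAdjoint_genInv D).star_eq, hD.isSelfAdjoint.star_eq] at this

theorem sqrtInvOp_mul_genInv_mul (hD : 0 ≤ D) : sqrtInvOp D * (genInv D * D) = sqrtInvOp D := by
  rw [genInv_mul hD.isSelfAdjoint, sqrtInvOp, cfc_mul_cfc]
  refine congrArg (fun f => cfc f D) (funext fun x => ?_)
  by_cases hx : x = 0 <;> simp [hx]

variable {V' : Type*} [NormedAddCommGroup V'] [InnerProductSpace ℂ V'] [CompleteSpace V']
  [FiniteDimensional ℂ V']

/-- The argument only uses the algebraic identities of the generalized inverse. -/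
theorem genInv_intertwine {D' : V' →L[ℂ] V'} (hD : IsSelfAdjoint D) (hD' : IsSelfAdjoint D')
    {J : V →L[ℂ] V'} (h : D' ∘L J = J ∘L D) : genInv D' ∘L J = J ∘L genInv D := by
  have h₁ : genInv D' = genInv D' ∘L genInv D' ∘L D' := by
    have := mul_genInv_genInv hD'
    rw [← genInv_comm hD', mul_assoc, ← genInv_comm hD'] at this
    exact this.symm
  have h₂ : genInv D = D ∘L genInv D ∘L genInv D := (mul_genInv_genInv hD).symm
  have h₃ : D ∘L genInv D ∘L D = D := mul_genInv_mul hD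
  have h₄ : D' ∘L genInv D' ∘L D' = D' := mul_genInv_mul hD'
  have h₅ : genInv D ∘L D = D ∘L genInv D := genInv_comm hD
  have h₆ : genInv D' ∘L D' = D' ∘L genInv D' := genInv_comm hD'
  -- Both sides equal `genInv D' ∘ J ∘ (D ∘ genInv D)`.
  calc genInv D' ∘L J = genInv D' ∘L genInv D' ∘L (D' ∘L J) := by
        conv_lhs => rw [h₁]
        simp only [comp_assoc]
    _ = genInv D' ∘L genInv D' ∘L (D' ∘L J) ∘L (D ∘L genInv D) := by
        rw [h]
        conv_lhs => rw [← h₃]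
        simp only [comp_assoc, h₅]
    _ = (genInv D' ∘L genInv D' ∘L D') ∘L J ∘L (D ∘L genInv D) := by simp only [comp_assoc]
    _ = genInv D' ∘L (D' ∘L J) ∘L genInv D := by
        rw [← h₁, h]
        simp only [comp_assoc]
    _ = (D' ∘L genInv D') ∘L J ∘L D ∘L genInv D ∘L genInv D := by
        conv_lhs => rw [h₂]
        simp only [← h₆, comp_assoc]
    _ = (D' ∘L genInv D' ∘L D') ∘L J ∘L genInv D ∘L genInv D := by
        rw [← comp_assoc J D, ← h]
        simp only [comp_assoc]
    _ = J ∘L genInv D := by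
        rw [h₄, ← comp_assoc D' J, h, comp_assoc, ← h₂]

end FunctionalCalculus

section Schur

variable {V : Type*} [NormedAddCommGroup V] [InnerProductSpace ℂ V]

@[simp] theorem block_zero_zero (P M : V →L[ℂ] V) : block P 0 0 M = P * M * P := rfl
@[simp] theorem block_zero_one (P M : V →L[ℂ] V) : block P 0 1 M = P * M * (1 - P) := rfl
@[simp] theorem block_one_zero (P M : V →L[ℂ] V) : block P 1 0 M = (1 - P) * M * P := rfl
@[simp] theorem block_one_one (P M : V →L[ℂ] V) : block P 1 1 M = (1 - P) * M * (1 - P) := rfl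

variable [CompleteSpace V]

variable {P M : V →L[ℂ] V}

theorem block_one_one_nonneg (hP : IsSelfAdjoint P) (hM : 0 ≤ M) : 0 ≤ block P 1 1 M := by
  have := star_left_conjugate_nonneg hM (1 - P)
  rwa [star_sub, star_one, hP.star_eq] at this

theorem block_star (hP : IsSelfAdjoint P) (hM : IsSelfAdjoint M) (x y : Fin 2) :
    star (block P x y M) = block P y x M := by
  have h : ∀ x, star ((![P, 1 - P] : Fin 2 → (V →L[ℂ] V)) x) = ![P, 1 - P] x := by
    intro x
    fin_cases x <;> simp [hP.star_eq]
  simp only [block, star_mul, h, hM.star_eq, mul_assoc]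

/-- The Schur complement of `M` with respect to the range of the projection `P`. -/
def schurCompl (P M : V →L[ℂ] V) : V →L[ℂ] V :=
  block P 0 0 M - block P 0 1 M * genInv (block P 1 1 M) * block P 1 0 M

theorem schurCompl_apply_range (hPP : P * P = P) (M : V →L[ℂ] V) (ξ : V) :
    schurCompl P M (P ξ) = schurCompl P M ξ := by
  have h : schurCompl P M * P = schurCompl P M := by
    simp only [schurCompl, block_zero_zero, block_one_zero, sub_mul, mul_assoc, hPP]
  exact congrArg (fun f => f ξ) h

variable [FiniteDimensional ℂ V]

/-- The kernel of the block `(1 - P) M (1 - P)` of a positive operator is annihilated by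
`M (1 - P)`; this makes the off-diagonal blocks compatible with the generalized inverse. -/
theorem mul_one_sub_genInv_block (hP : IsSelfAdjoint P) (hM : 0 ≤ M) :
    M * (1 - P) * (genInv (block P 1 1 M) * block P 1 1 M) = M * (1 - P) := by
  set D := block P 1 1 M with hD
  have hD0 : 0 ≤ D := block_one_one_nonneg hP hM
  set s := sqrtOp M
  have hs : star s = s := (isSelfAdjoint_sqrtOp M).star_eq
  have hss : s * s = M := sqrtOp_mul_sqrtOp hM
  set z := 1 - genInv D * D
  have hDz : D * z = 0 := by
    rw [mul_sub, mul_one, ← mul_assoc, mul_genInv_mul hD0.isSelfAdjoint, sub_self]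
  have h : s * (1 - P) * z = 0 := by
    rw [← CStarRing.star_mul_self_eq_zero_iff]
    have : star (s * (1 - P) * z) * (s * (1 - P) * z) = star z * (D * z) := by
      rw [hD, block_one_one, ← hss]
      simp only [star_mul, star_sub, star_one, hP.star_eq, hs, mul_assoc]
    rw [this, hDz, mul_zero]
  have h2 : M * (1 - P) * z = 0 := by
    rw [← hss, mul_assoc, mul_assoc, ← mul_assoc s (1 - P) z, h, mul_zero]
  rw [mul_sub, mul_one, sub_eq_zero] at h2
  exact h2.symm

theorem block_mul_genInv_mul (hP : IsSelfAdjoint P) (hM : 0 ≤ M) :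
    block P 0 1 M * (genInv (block P 1 1 M) * block P 1 1 M) = block P 0 1 M := by
  rw [block_zero_one, mul_assoc P M, mul_assoc P, mul_one_sub_genInv_block hP hM]

theorem mul_genInv_mul_block (hP : IsSelfAdjoint P) (hM : 0 ≤ M) :
    block P 1 1 M * genInv (block P 1 1 M) * block P 1 0 M = block P 1 0 M := by
  have := congrArg star (block_mul_genInv_mul hP hM)
  rwa [star_mul, star_mul, block_star hP hM.isSelfAdjoint, block_star hP hM.isSelfAdjoint,
    (isSelfAdjoint_genInv _).star_eq] at this

theorem genInv_block_mul (hP : IsSelfAdjoint P) (hPP : P * P = P) (hM : 0 ≤ M) :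
    genInv (block P 1 1 M) * P = 0 := by
  have hD := (block_one_one_nonneg hP hM).isSelfAdjoint
  have h := mul_genInv_genInv hD
  rw [← genInv_comm hD, mul_assoc, ← genInv_comm hD] at h
  have h₀ : block P 1 1 M * P = 0 := by
    rw [block_one_one, mul_assoc, sub_mul 1 P P, one_mul, hPP, sub_self, mul_zero]
  calc genInv (block P 1 1 M) * P
      = genInv (block P 1 1 M) * (genInv (block P 1 1 M) * block P 1 1 M) * P := by rw [h]
    _ = 0 := by rw [mul_assoc, mul_assoc, h₀, mul_zero, mul_zero]

theorem schurCompl_eq (hP : IsSelfAdjoint P) (hPP : P * P = P) (hM : 0 ≤ M) :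
    schurCompl P M = (P - block P 0 1 M * genInv (block P 1 1 M)) * M := by
  set G := genInv (block P 1 1 M) with hG
  have hGP : G * (1 - P) = G := by rw [mul_sub, mul_one, genInv_block_mul hP hPP hM, sub_zero]
  have h₁ := block_mul_genInv_mul hP hM
  rw [← hG, ← mul_assoc, block_one_one, block_zero_one] at h₁
  have h₂ : (P - block P 0 1 M * G) * M * (1 - P) = 0 := by
    rw [sub_mul, sub_mul, ← hGP, block_zero_one, sub_eq_zero]
    simp only [mul_assoc] at h₁ ⊢
    exact h₁.symm
  have h₃ : (P - block P 0 1 M * G) * M * P = schurCompl P M := by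
    conv_lhs => rw [← hGP]
    simp only [schurCompl, ← hG, block_zero_zero, block_one_zero, sub_mul, mul_assoc]
  rw [← h₃, ← add_zero ((P - block P 0 1 M * G) * M * P), ← h₂, ← mul_add, add_sub_cancel, mul_one]

theorem schurCompl_nonneg (hP : IsSelfAdjoint P) (hPP : P * P = P) (hM : 0 ≤ M) :
    0 ≤ schurCompl P M := by
  set G := genInv (block P 1 1 M) with hG
  have hPG : P * G = 0 := by
    have := congrArg star (genInv_block_mul hP hPP hM)
    rwa [star_mul, star_zero, hP.star_eq, (isSelfAdjoint_genInv _).star_eq] at this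
  have h₂ : schurCompl P M * (P - G * block P 1 0 M) = schurCompl P M := by
    have h : schurCompl P M * P = schurCompl P M := by
      simp only [schurCompl, block_zero_zero, block_one_zero, sub_mul, mul_assoc, hPP]
    rw [mul_sub, ← mul_assoc, h, ← h, mul_assoc _ P, hPG, mul_zero, zero_mul, sub_zero]
  have h₁ : star (P - block P 0 1 M * G) = P - G * block P 1 0 M := by
    rw [star_sub, star_mul, hP.star_eq, block_star hP hM.isSelfAdjoint,
      (isSelfAdjoint_genInv _).star_eq]
  rw [← h₂, schurCompl_eq hP hPP hM, ← h₁]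
  exact star_right_conjugate_nonneg hM _

/-- If `M` and `Q` agree at `ξ`, where `Q` has values in the range of `P`, then the Schur complement
of `M` agrees with `Q` at `ξ`. -/
theorem schurCompl_apply_eq (hP : IsSelfAdjoint P) (hPP : P * P = P) (hM : 0 ≤ M)
    {Q : V →L[ℂ] V} (hQ : P * Q = Q) {ξ : V} (hξ : M ξ = Q ξ) : schurCompl P M ξ = Q ξ := by
  have h : (P - block P 0 1 M * genInv (block P 1 1 M)) * Q = Q := by
    rw [sub_mul, hQ, mul_assoc, ← hQ, ← mul_assoc (genInv _), genInv_block_mul hP hPP hM,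
      zero_mul, mul_zero, sub_zero]
  have h' := congrArg (fun f => f ξ) (schurCompl_eq hP hPP hM)
  refine h'.trans ?_
  change (P - block P 0 1 M * genInv (block P 1 1 M)) (M ξ) = Q ξ
  rw [hξ]
  exact congrArg (fun f => f ξ) h

/-- Positivity of the Schur complement bounds `D^{-1/2} M₂₁`, where `D = M₂₂`, independently of how
small the nonzero eigenvalues of `D` are. -/
theorem norm_sqrtInvOp_mul_block_sq_le (hP : IsSelfAdjoint P) (hPP : P * P = P) (hM : 0 ≤ M) :
    ‖sqrtInvOp (block P 1 1 M) * block P 1 0 M‖ ^ 2 ≤ ‖block P 0 0 M‖ := by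
  set D := block P 1 1 M with hD
  have e : star (sqrtInvOp D * block P 1 0 M) * (sqrtInvOp D * block P 1 0 M) =
      block P 0 1 M * genInv D * block P 1 0 M := by
    rw [← sqrtInvOp_mul_sqrtInvOp (block_one_one_nonneg hP hM), star_mul,
      block_star hP hM.isSelfAdjoint, (isSelfAdjoint_sqrtInvOp _).star_eq]
    simp only [hD, mul_assoc]
  rw [sq, ← CStarRing.norm_star_mul_self, e]
  refine CStarAlgebra.norm_le_norm_of_nonneg_of_le ?_ ?_
  · rw [← e]
    exact star_mul_self_nonneg _
  · exact sub_nonneg.1 (schurCompl_nonneg hP hPP hM)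

end Schur

/-! ### Compressions of operators on tensor products -/

section Compress

variable {H E : Type*} [NormedAddCommGroup H] [InnerProductSpace ℂ H]
  [NormedAddCommGroup E] [InnerProductSpace ℂ E]

theorem compress_apply (x y : E) (T : H ⊗[ℂ] E →L[ℂ] H ⊗[ℂ] E) (a : H) :
    compress x y T a = TensorProduct.rid ℂ H
      (TensorProduct.mapL (1 : H →L[ℂ] H) (innerSL ℂ x) (T (a ⊗ₜ y))) := rfl

theorem inner_rid_mapL (a : H) (x : E) (z : H ⊗[ℂ] E) :
    ⟪a, TensorProduct.rid ℂ H (TensorProduct.mapL (1 : H →L[ℂ] H) (innerSL ℂ x) z)⟫_ℂ =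
      ⟪a ⊗ₜ[ℂ] x, z⟫_ℂ := by
  induction z using TensorProduct.induction_on with
  | zero => simp
  | tmul b y =>
    rw [TensorProduct.mapL_tmul, TensorProduct.rid_tmul, inner_smul_right,
      TensorProduct.inner_tmul, one_apply_eq_self, innerSL_apply_apply, mul_comm]
  | add z w hz hw => rw [map_add, map_add, inner_add_right, inner_add_right, hz, hw]

theorem inner_compress (x y : E) (T : H ⊗[ℂ] E →L[ℂ] H ⊗[ℂ] E) (a b : H) :
    ⟪a, compress x y T b⟫_ℂ = ⟪a ⊗ₜ[ℂ] x, T (b ⊗ₜ y)⟫_ℂ := by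
  rw [compress_apply, inner_rid_mapL]

theorem norm_compress_le (x y : E) (T : H ⊗[ℂ] E →L[ℂ] H ⊗[ℂ] E) :
    ‖compress x y T‖ ≤ ‖x‖ * ‖T‖ * ‖y‖ := by
  refine opNorm_le_bound _ (by positivity) fun b => ?_
  rw [compress_apply, TensorProduct.norm_rid]
  calc _ ≤ ‖TensorProduct.mapL (1 : H →L[ℂ] H) (innerSL ℂ x)‖ * ‖T (b ⊗ₜ y)‖ := le_opNorm _ _
    _ ≤ (1 * ‖x‖) * (‖T‖ * (‖b‖ * ‖y‖)) := by
        refine mul_le_mul ?_ ?_ (norm_nonneg _) (by positivity)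
        · refine (TensorProduct.norm_mapL_le _ _).trans ?_
          rw [innerSL_apply_norm]
          exact mul_le_mul_of_nonneg_right ContinuousLinearMap.norm_id_le (norm_nonneg _)
        · refine (le_opNorm _ _).trans ?_
          rw [TensorProduct.norm_tmul]
    _ = _ := by ring

theorem sum_rid_mapL_tmul {ι : Type*} [Fintype ι] (b : OrthonormalBasis ι ℂ E)
    (z : H ⊗[ℂ] E) :
    ∑ i, TensorProduct.rid ℂ H
      (TensorProduct.mapL (1 : H →L[ℂ] H) (innerSL ℂ (b i)) z) ⊗ₜ[ℂ] b i = z := by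
  induction z using TensorProduct.induction_on with
  | zero => simp
  | tmul a y =>
    conv_rhs => rw [← b.sum_repr' y]
    simp [TensorProduct.tmul_sum, TensorProduct.smul_tmul]
  | add z w hz hw =>
    simp only [map_add, TensorProduct.add_tmul, Finset.sum_add_distrib, hz, hw]

theorem sum_compress_apply_tmul {ι : Type*} [Fintype ι] (b : OrthonormalBasis ι ℂ E)
    (T : H ⊗[ℂ] E →L[ℂ] H ⊗[ℂ] E) (a : H) (y : E) :
    ∑ i, ∑ j, compress (b i) (b j) T a ⊗ₜ[ℂ] (⟪b j, y⟫_ℂ • b i) = T (a ⊗ₜ y) := by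
  have hy : a ⊗ₜ[ℂ] y = ∑ j, ⟪b j, y⟫_ℂ • a ⊗ₜ[ℂ] b j := by
    conv_lhs => rw [← b.sum_repr' y]
    simp [TensorProduct.tmul_sum]
  rw [hy, ← sum_rid_mapL_tmul b (T _), map_sum]
  simp only [map_smul, map_sum, TensorProduct.sum_tmul, TensorProduct.tmul_smul, compress_apply,
    ← TensorProduct.smul_tmul']

end Compress

/-! ### Direct sums of operators on `ℋ` and on `ℋ ⊗ E` -/

section DirectSum

variable {k : ℕ} {c₁ c₂ : ℝ}

open Classical in
theorem inner_incl (ω : Index.{u} k c₁ c₂) (a : Coord.{u} ω.n) (x : BigSpace.{u} k c₁ c₂) :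
    ⟪incl ω a, x⟫_ℂ = ⟪a, x ω⟫_ℂ :=
  lp.inner_single_left ω a x

open Classical in
theorem norm_incl (ω : Index.{u} k c₁ c₂) (a : Coord.{u} ω.n) : ‖incl ω a‖ = ‖a‖ :=
  lp.norm_single (E := fun ω : Index.{u} k c₁ c₂ => Coord.{u} ω.n) (p := 2) two_pos ω a

open Classical in
theorem incl_apply_self (ω : Index.{u} k c₁ c₂) (a : Coord.{u} ω.n) : incl ω a ω = a :=
  lp.single_apply_self (E := fun ω : Index.{u} k c₁ c₂ => Coord.{u} ω.n) 2 ω a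

open Classical in
theorem incl_apply_ne {ω ω' : Index.{u} k c₁ c₂} (h : ω' ≠ ω) (a : Coord.{u} ω.n) :
    incl ω a ω' = 0 :=
  lp.single_apply_ne (E := fun ω : Index.{u} k c₁ c₂ => Coord.{u} ω.n) 2 ω a h

open Classical in
theorem ext_incl {Z : Type*} [AddCommGroup Z] [Module ℂ Z] [TopologicalSpace Z] [T2Space Z]
    {T T' : BigSpace.{u} k c₁ c₂ →L[ℂ] Z} (h : ∀ ω a, T (incl ω a) = T' (incl ω a)) : T = T' :=
  lp.ext_continuousLinearMap (by norm_num) fun ω => ContinuousLinearMap.ext fun b => h ω b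

theorem exists_isDirectSum {t : ∀ ω : Index.{u} k c₁ c₂, Coord.{u} ω.n →L[ℂ] Coord.{u} ω.n}
    {C : ℝ} (ht : ∀ ω, ‖t ω‖ ≤ C) :
    ∃ T : BigSpace.{u} k c₁ c₂ →L[ℂ] BigSpace.{u} k c₁ c₂, IsDirectSum T t := by
  have hb : ∀ (x : BigSpace.{u} k c₁ c₂) ω, ‖t ω (x ω)‖ ≤ ‖((|C| : ℝ) : ℂ) • x ω‖ := by
    intro x ω
    rw [norm_smul, Complex.norm_real, Real.norm_eq_abs, abs_abs]
    exact (le_opNorm _ _).trans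
      (mul_le_mul_of_nonneg_right ((ht ω).trans (le_abs_self C)) (norm_nonneg _))
  have hmem : ∀ x : BigSpace.{u} k c₁ c₂, Memℓp (fun ω => t ω (x ω)) 2 := fun x =>
    ((lp.memℓp x).const_smul ((|C| : ℝ) : ℂ)).mono' (hb x)
  let T₀ : BigSpace.{u} k c₁ c₂ →ₗ[ℂ] BigSpace.{u} k c₁ c₂ :=
    { toFun := fun x => ⟨fun ω => t ω (x ω), hmem x⟩
      map_add' := fun x y => lp.ext (funext fun ω => map_add (t ω) (x ω) (y ω))
      map_smul' := fun c x => lp.ext (funext fun ω => map_smul (t ω) c (x ω)) }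
  refine ⟨T₀.mkContinuous |C| fun x => ?_, fun ω a => lp.ext (funext fun ω' => ?_)⟩
  · have h := lp.norm_mono two_ne_zero (x := T₀ x) (y := ((|C| : ℝ) : ℂ) • x) (hb x)
    rwa [norm_smul, Complex.norm_real, Real.norm_eq_abs, abs_abs] at h
  · change t ω' (incl ω a ω') = incl ω (t ω a) ω'
    by_cases h : ω' = ω
    · subst h
      rw [incl_apply_self, incl_apply_self]
    · rw [incl_apply_ne h, incl_apply_ne h, map_zero]

variable {E : Type*} [NormedAddCommGroup E] [InnerProductSpace ℂ E]

/-- The inclusion of `(ℂⁿ)* ⊗ E` into `ℋ ⊗ E`. -/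
abbrev inclTensor (E : Type*) [NormedAddCommGroup E] [InnerProductSpace ℂ E]
    (ω : Index.{u} k c₁ c₂) : Coord.{u} ω.n ⊗[ℂ] E →L[ℂ] BigSpace.{u} k c₁ c₂ ⊗[ℂ] E :=
  TensorProduct.mapL (incl ω) 1

/-- The projection of `ℋ ⊗ E` onto the summand `(ℂⁿ)* ⊗ E`. -/
def projTensor (E : Type*) [NormedAddCommGroup E] [InnerProductSpace ℂ E]
    (ω : Index.{u} k c₁ c₂) : BigSpace.{u} k c₁ c₂ ⊗[ℂ] E →L[ℂ] Coord.{u} ω.n ⊗[ℂ] E :=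
  TensorProduct.mapL (lp.evalCLM ℂ _ 2 ω) 1

/-- Operators on `ℋ ⊗ E` are determined by their restrictions to the summands. -/
theorem ext_inclTensor {Z : Type*} [AddCommGroup Z] [Module ℂ Z] [TopologicalSpace Z] [T2Space Z]
    {T T' : BigSpace.{u} k c₁ c₂ ⊗[ℂ] E →L[ℂ] Z}
    (h : ∀ ω z, T (inclTensor E ω z) = T' (inclTensor E ω z)) : T = T' := by
  refine ContinuousLinearMap.ext fun z => ?_
  induction z using TensorProduct.induction_on with
  | zero => rw [map_zero, map_zero]
  | tmul a y =>
    have : T ∘L (TensorProduct.mkL ℂ _ E).flip y = T' ∘L (TensorProduct.mkL ℂ _ E).flip y := by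
      refine ext_incl fun ω b => ?_
      have := h ω (b ⊗ₜ y)
      rwa [TensorProduct.mapL_tmul, one_apply_eq_self] at this
    exact congrArg (fun f => f a) this
  | add z w hz hw => rw [map_add, map_add, hz, hw]

theorem inner_inclTensor (ω : Index.{u} k c₁ c₂) (a : Coord.{u} ω.n ⊗[ℂ] E)
    (z : BigSpace.{u} k c₁ c₂ ⊗[ℂ] E) :
    ⟪inclTensor E ω a, z⟫_ℂ = ⟪a, projTensor E ω z⟫_ℂ := by
  induction a using TensorProduct.induction_on with
  | zero => simp
  | tmul b x =>
    induction z using TensorProduct.induction_on with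
    | zero => simp
    | tmul a y =>
      rw [projTensor, TensorProduct.mapL_tmul, TensorProduct.mapL_tmul, TensorProduct.inner_tmul,
        TensorProduct.inner_tmul, inner_incl]
      rfl
    | add z w hz hw => rw [map_add, inner_add_right, inner_add_right, hz, hw]
  | add b c hb hc => rw [map_add, inner_add_left, inner_add_left, hb, hc]

theorem ext_projTensor {z : BigSpace.{u} k c₁ c₂ ⊗[ℂ] E}
    (h : ∀ ω, projTensor E ω z = 0) : z = 0 := by
  have : innerSL ℂ z = 0 := ext_inclTensor fun ω a => by
    rw [innerSL_apply_apply, ← inner_conj_symm, inner_inclTensor, h, inner_zero_right, map_zero,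
      zero_apply]
  have h' := congrArg (fun f => f z) this
  simpa using h'

namespace IsDirectSumTensor

variable {T T' : BigSpace.{u} k c₁ c₂ ⊗[ℂ] E →L[ℂ] BigSpace.{u} k c₁ c₂ ⊗[ℂ] E}
  {t t' : ∀ ω : Index.{u} k c₁ c₂, Coord.{u} ω.n ⊗[ℂ] E →L[ℂ] Coord.{u} ω.n ⊗[ℂ] E}

theorem unique (h : IsDirectSumTensor T t) (h' : IsDirectSumTensor T' t) : T = T' :=
  ext_inclTensor fun ω z => (h ω z).trans (h' ω z).symm

theorem congr (h : IsDirectSumTensor T t) (e : ∀ ω, t ω = t' ω) : IsDirectSumTensor T t' :=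
  fun ω z => (h ω z).trans (by rw [e])

theorem sub (h : IsDirectSumTensor T t) (h' : IsDirectSumTensor T' t') :
    IsDirectSumTensor (T - T') (fun ω => t ω - t' ω) := fun ω z => by
  rw [sub_apply, sub_apply, map_sub, h, h']

theorem mul (h : IsDirectSumTensor T t) (h' : IsDirectSumTensor T' t') :
    IsDirectSumTensor (T * T') (fun ω => t ω * t' ω) := fun ω z =>
  (congrArg T (h' ω z)).trans (h ω (t' ω z))

theorem projTensor_apply (h : IsDirectSumTensor T t) (ω : Index.{u} k c₁ c₂)
    (z : BigSpace.{u} k c₁ c₂ ⊗[ℂ] E) : projTensor E ω (T z) = t ω (projTensor E ω z) := by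
  have hp : ∀ ω' a, ω' ≠ ω → projTensor E ω (inclTensor E ω' a) = 0 := by
    intro ω' a hω
    induction a using TensorProduct.induction_on with
    | zero => rw [map_zero, map_zero]
    | tmul b x =>
      rw [projTensor, TensorProduct.mapL_tmul, TensorProduct.mapL_tmul]
      rw [show lp.evalCLM ℂ (fun ω : Index.{u} k c₁ c₂ => Coord.{u} ω.n) 2 ω (incl ω' b) = 0 from
        incl_apply_ne hω.symm b, TensorProduct.zero_tmul]
    | add z w hz hw => rw [map_add, map_add, hz, hw, add_zero]
  have hs : ∀ a, projTensor E ω (inclTensor E ω a) = a := by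
    intro a
    induction a using TensorProduct.induction_on with
    | zero => rw [map_zero, map_zero]
    | tmul b x =>
      rw [projTensor, TensorProduct.mapL_tmul, TensorProduct.mapL_tmul]
      rw [show lp.evalCLM ℂ (fun ω : Index.{u} k c₁ c₂ => Coord.{u} ω.n) 2 ω (incl ω b) = b from
        incl_apply_self ω b]
      rfl
    | add z w hz hw => rw [map_add, map_add, hz, hw]
  have : projTensor E ω ∘L T = t ω ∘L projTensor E ω := ext_inclTensor fun ω' a => by
    rw [comp_apply, comp_apply, h ω' a]
    by_cases hω : ω' = ω
    · subst hω
      rw [hs, hs]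
    · rw [hp _ _ hω, hp _ _ hω, map_zero]
  exact congrArg (fun f => f z) this

theorem inner_left (h : IsDirectSumTensor T t) (h' : IsDirectSumTensor T' t')
    (ha : ∀ ω a b, ⟪t ω a, b⟫_ℂ = ⟪a, t' ω b⟫_ℂ) (x y : BigSpace.{u} k c₁ c₂ ⊗[ℂ] E) :
    ⟪T x, y⟫_ℂ = ⟪x, T' y⟫_ℂ := by
  have : innerSL ℂ (T x) = innerSL ℂ x ∘L T' := ext_inclTensor fun ω a => by
    have e : ∀ (z : BigSpace.{u} k c₁ c₂ ⊗[ℂ] E) (b : Coord.{u} ω.n ⊗[ℂ] E),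
        ⟪z, inclTensor E ω b⟫_ℂ = ⟪projTensor E ω z, b⟫_ℂ := fun z b =>
      ((inner_conj_symm (𝕜 := ℂ) (E := BigSpace.{u} k c₁ c₂ ⊗[ℂ] E) _ _).symm.trans
        (congrArg conj (inner_inclTensor ω b z))).trans
          (inner_conj_symm (𝕜 := ℂ) (E := Coord.{u} ω.n ⊗[ℂ] E) _ _)
    rw [comp_apply, innerSL_apply_apply, innerSL_apply_apply, h' ω a, e, e, h.projTensor_apply, ha]
  exact congrArg (fun f => f y) this

theorem compress {T : BigSpace.{u} k c₁ c₂ ⊗[ℂ] E →L[ℂ] BigSpace.{u} k c₁ c₂ ⊗[ℂ] E}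
    (h : IsDirectSumTensor T t) (x y : E) :
    IsDirectSum (compress x y T) (fun ω => FreeLoewner.compress x y (t ω)) := by
  have hr : ∀ ω (z : Coord.{u} ω.n ⊗[ℂ] E), TensorProduct.rid ℂ (BigSpace.{u} k c₁ c₂)
      (TensorProduct.mapL 1 (innerSL ℂ x) (inclTensor E ω z)) =
      incl ω (TensorProduct.rid ℂ _ (TensorProduct.mapL 1 (innerSL ℂ x) z)) := by
    intro ω z
    induction z using TensorProduct.induction_on with
    | zero => simp only [map_zero]
    | tmul b y => simp
    | add z w hz hw => simp only [map_add, hz, hw]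
  intro ω a
  have h₁ := h ω (a ⊗ₜ y)
  rw [TensorProduct.mapL_tmul, one_apply_eq_self] at h₁
  rw [compress_apply, compress_apply, h₁, hr]

end IsDirectSumTensor

theorem IsDirectSum.unique {T T' : BigSpace.{u} k c₁ c₂ →L[ℂ] BigSpace.{u} k c₁ c₂}
    {t : ∀ ω : Index.{u} k c₁ c₂, Coord.{u} ω.n →L[ℂ] Coord.{u} ω.n}
    (h : IsDirectSum T t) (h' : IsDirectSum T' t) : T = T' :=
  ext_incl fun ω b => (h ω b).trans (h' ω b).symm

theorem exists_isDirectSumTensor [FiniteDimensional ℂ E]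
    {t : ∀ ω : Index.{u} k c₁ c₂, Coord.{u} ω.n ⊗[ℂ] E →L[ℂ] Coord.{u} ω.n ⊗[ℂ] E}
    {C : ℝ} (ht : ∀ ω, ‖t ω‖ ≤ C) :
    ∃ T : BigSpace.{u} k c₁ c₂ ⊗[ℂ] E →L[ℂ] BigSpace.{u} k c₁ c₂ ⊗[ℂ] E,
      IsDirectSumTensor T t := by
  set b := stdOrthonormalBasis ℂ E
  have hc : ∀ i j ω, ‖compress (b i) (b j) (t ω)‖ ≤ C := by
    intro i j ω
    refine (norm_compress_le _ _ _).trans ?_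
    rw [b.norm_eq_one, b.norm_eq_one, one_mul, mul_one]
    exact ht ω
  choose D hD using fun i j => exists_isDirectSum (hc i j)
  refine ⟨∑ i, ∑ j, TensorProduct.mapL (D i j) (InnerProductSpace.rankOne ℂ (b i) (b j)),
    fun ω z => ?_⟩
  induction z using TensorProduct.induction_on with
  | zero => simp only [map_zero]
  | tmul a y =>
    rw [← sum_compress_apply_tmul b]
    simp only [sum_apply, map_sum, TensorProduct.mapL_tmul, one_apply_eq_self, hD _ _ ω a,
      InnerProductSpace.rankOne_apply]
  | add z w hz hw => simp only [map_add, hz, hw]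

theorem isDirectSumTensor_pencil
    {b : Fin (k + 1) → (BigSpace.{u} k c₁ c₂ →L[ℂ] BigSpace.{u} k c₁ c₂)}
    {t : PencilSystem.{u} k c₁ c₂} (hb : ∀ i, IsDirectSum (b i) (fun ω => t ω i))
    (X : Fin k → (E →L[ℂ] E)) :
    IsDirectSumTensor (pencil b X) (fun ω => pencil (t ω) X) := by
  have h : ∀ i (Z : E →L[ℂ] E) ω (z : Coord.{u} ω.n ⊗[ℂ] E),
      TensorProduct.mapL (b i) Z (inclTensor E ω z) =
        inclTensor E ω (TensorProduct.mapL (t ω i) Z z) := by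
    intro i Z ω z
    induction z using TensorProduct.induction_on with
    | zero => simp only [map_zero]
    | tmul a y => simp only [TensorProduct.mapL_tmul, hb i ω a, one_apply_eq_self]
    | add z w hz hw => simp only [map_add, hz, hw]
  intro ω z
  simp only [pencil, add_apply, sum_apply, map_add, map_sum, h]

end DirectSum

/-! ### Schur complements of pencils -/

section PencilAlgebra

variable {k : ℕ} {V E E' : Type*} [NormedAddCommGroup V] [InnerProductSpace ℂ V]
  [NormedAddCommGroup E] [InnerProductSpace ℂ E]
  [NormedAddCommGroup E'] [InnerProductSpace ℂ E']

theorem pencil_block (P : V →L[ℂ] V) (x y : Fin 2) (B : Fin (k + 1) → (V →L[ℂ] V))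
    (X : Fin k → (E →L[ℂ] E)) :
    pencil (fun i => block P x y (B i)) X = block (TensorProduct.mapL P 1) x y (pencil B X) := by
  have hP : ∀ z, TensorProduct.mapL ((![P, 1 - P] : Fin 2 → (V →L[ℂ] V)) z) (1 : E →L[ℂ] E) =
      ![TensorProduct.mapL P 1, 1 - TensorProduct.mapL P 1] z := by
    intro z
    fin_cases z
    · rfl
    · rw [eq_comm]
      change 1 - TensorProduct.mapL P 1 = TensorProduct.mapL (1 - P) 1
      rw [sub_eq_iff_eq_add, ← TensorProduct.mapL_add_left, sub_add_cancel]
      exact TensorProduct.mapL_id_id.symm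
  have h : ∀ (C : V →L[ℂ] V) (Z : E →L[ℂ] E), TensorProduct.mapL (block P x y C) Z =
      block (TensorProduct.mapL P 1) x y (TensorProduct.mapL C Z) := by
    intro C Z
    rw [block, block, ← hP, ← hP, ← TensorProduct.mapL_mul, ← TensorProduct.mapL_mul, one_mul,
      mul_one]
  simp only [pencil, h]
  simp only [block, mul_add, add_mul, Finset.mul_sum, Finset.sum_mul]

theorem pencil_intertwine {J : E →L[ℂ] E'} {X : Fin k → (E →L[ℂ] E)}
    {X' : Fin k → (E' →L[ℂ] E')} (h : ∀ i, X' i ∘L J = J ∘L X i)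
    (B : Fin (k + 1) → (V →L[ℂ] V)) :
    pencil B X' ∘L TensorProduct.mapL 1 J = TensorProduct.mapL 1 J ∘L pencil B X := by
  have h' : ∀ i z, X' i (J z) = J (X i z) := fun i z => congrArg (fun f => f z) (h i)
  refine ContinuousLinearMap.ext fun z => ?_
  induction z using TensorProduct.induction_on with
  | zero => rw [map_zero, map_zero]
  | tmul a y => simp [pencil, h']
  | add z w hz hw => rw [map_add, map_add, hz, hw]

theorem norm_pencil_le {B : Fin (k + 1) → (V →L[ℂ] V)} {C : ℝ} (hB : ∀ i, ‖B i‖ ≤ C)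
    (X : Fin k → (E →L[ℂ] E)) :
    ‖pencil B X‖ ≤ C * (1 + ∑ i : Fin k, ‖X i - 1‖) := by
  have hC : 0 ≤ C := (norm_nonneg _).trans (hB 0)
  rw [mul_add, mul_one, Finset.mul_sum]
  rw [pencil]
  refine (norm_add_le (TensorProduct.mapL (B 0) (1 : E →L[ℂ] E)) _).trans (add_le_add ?_ ?_)
  · exact (TensorProduct.norm_mapL_le _ _).trans ((mul_le_mul (hB 0)
      ContinuousLinearMap.norm_id_le (norm_nonneg _) hC).trans_eq (mul_one C))
  · refine (norm_sum_le Finset.univ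
      fun i : Fin k => TensorProduct.mapL (B i.succ) (X i - 1)).trans (Finset.sum_le_sum fun i _ => ?_)
    exact (TensorProduct.norm_mapL_le _ _).trans
      (mul_le_mul_of_nonneg_right (hB _) (norm_nonneg _))

end PencilAlgebra

section Projection

variable {n : ℕ}

theorem norm_dualVec (v : Coord.{u} n) : ‖dualVec v‖ = ‖v‖ := by
  simp [EuclideanSpace.norm_eq, dualVec]

theorem isSelfAdjoint_dualProj (v : Coord.{u} n) : IsSelfAdjoint (dualProj v) :=
  (InnerProductSpace.isPositive_rankOne_self (𝕜 := ℂ) (dualVec v)).isSelfAdjoint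

theorem dualProj_mul_self {v : Coord.{u} n} (hv : ‖v‖ = 1) : dualProj v * dualProj v = dualProj v :=
  InnerProductSpace.isIdempotentElem_rankOne_self (by rw [norm_dualVec, hv])

variable {E : Type*} [NormedAddCommGroup E] [InnerProductSpace ℂ E]

/-- The projection of `(ℂⁿ)* ⊗ E` onto `ℂ v* ⊗ E`. -/
def tensorProj (E : Type*) [NormedAddCommGroup E] [InnerProductSpace ℂ E]
    (v : Coord.{u} n) : Coord.{u} n ⊗[ℂ] E →L[ℂ] Coord.{u} n ⊗[ℂ] E :=
  TensorProduct.mapL (dualProj v) 1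

theorem isSelfAdjoint_tensorProj [FiniteDimensional ℂ E] (v : Coord.{u} n) : IsSelfAdjoint (tensorProj E v) := by
  have : CompleteSpace E := FiniteDimensional.complete ℂ E
  rw [IsSelfAdjoint, star_eq_adjoint, tensorProj, TensorProduct.adjoint_mapL,
    (isSelfAdjoint_dualProj v).adjoint_eq, ← star_eq_adjoint, star_one]

theorem tensorProj_mul_self {v : Coord.{u} n} (hv : ‖v‖ = 1) :
    tensorProj E v * tensorProj E v = tensorProj E v := by
  rw [tensorProj, ← TensorProduct.mapL_mul, dualProj_mul_self hv, one_mul]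

theorem mapL_dualProj_canonicalVec (v : Coord.{u} n) (Z : Coord.{u} n →L[ℂ] Coord.{u} n) :
    TensorProduct.mapL (dualProj v) Z (canonicalVec n) = dualVec v ⊗ₜ[ℂ] Z v := by
  have hZ : Z v = ∑ a, v a • Z (EuclideanSpace.single a 1) := by
    conv_lhs => rw [← sum_smul_single v]
    simp only [map_sum, map_smul]
  rw [hZ]
  simp only [canonicalVec, map_sum, TensorProduct.mapL_tmul, TensorProduct.tmul_sum,
    TensorProduct.tmul_smul, dualProj, InnerProductSpace.rankOne_apply,
    EuclideanSpace.inner_single_right, ← TensorProduct.smul_tmul']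
  simp [dualVec]

variable [FiniteDimensional ℂ E] {k : ℕ}

theorem schurBlock_eq (v : Coord.{u} n) (B : Fin (k + 1) → (Coord.{u} n →L[ℂ] Coord.{u} n))
    (X : Fin k → (E →L[ℂ] E)) :
    schurBlock v B X = schurCompl (tensorProj E v) (pencil B X) := by
  simp only [schurBlock, pencil_block]
  rfl

end Projection

/-! ### Supporting pencils: bounds and the value at the supporting point -/

section Supporting

variable {k n : ℕ} {F : GradedFunction.{u} k} {c₁ c₂ : ℝ}
  {A : Fin k → (Coord.{u} n →L[ℂ] Coord.{u} n)} {v : Coord.{u} n}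
  {B : Fin (k + 1) → (Coord.{u} n →L[ℂ] Coord.{u} n)}

/-- The operator norm of a positive matrix is at most its trace. -/
theorem norm_le_re_trace {D : Coord.{u} n →L[ℂ] Coord.{u} n} (hD : D.IsPositive) :
    ‖D‖ ≤ (LinearMap.trace ℂ (Coord.{u} n) D.toLinearMap).re := by
  have hD0 : 0 ≤ D := (nonneg_iff_isPositive D).2 hD
  set s := sqrtOp D
  have hs : IsSelfAdjoint s := isSelfAdjoint_sqrtOp D
  have hss : s * s = D := sqrtOp_mul_sqrtOp hD0
  have htr : (LinearMap.trace ℂ (Coord.{u} n) D.toLinearMap).re =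
      ∑ a, ‖s (EuclideanSpace.single a 1)‖ ^ 2 := by
    rw [LinearMap.trace_eq_sum_inner _ (EuclideanSpace.basisFun (ULift.{u} (Fin n)) ℂ),
      Complex.re_sum]
    refine Finset.sum_congr rfl fun a _ => ?_
    rw [EuclideanSpace.basisFun_apply, ContinuousLinearMap.coe_coe, ← hss,
      show ∀ x, (s * s) x = s (s x) from fun _ => rfl, ← adjoint_inner_left, hs.adjoint_eq,
      inner_self_eq_norm_sq_to_K]
    norm_cast
  have hn : ‖D‖ = ‖s‖ ^ 2 := by
    rw [← hss, sq, ← CStarRing.norm_star_mul_self, hs.star_eq]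
  rw [htr, hn]
  refine (Real.le_sqrt (norm_nonneg _) (Finset.sum_nonneg fun _ _ => by positivity)).1
    (opNorm_le_bound _ (Real.sqrt_nonneg _) fun x => ?_)
  calc ‖s x‖ = ‖∑ a, x a • s (EuclideanSpace.single a 1)‖ := by
        conv_lhs => rw [← sum_smul_single x]
        simp only [map_sum, map_smul]
    _ ≤ ∑ a, ‖s (EuclideanSpace.single a 1)‖ * ‖x a‖ :=
        (norm_sum_le _ _).trans_eq (Finset.sum_congr rfl fun a _ => by rw [norm_smul, mul_comm])
    _ ≤ √(∑ a, ‖s (EuclideanSpace.single a 1)‖ ^ 2) * √(∑ a, ‖x a‖ ^ 2) :=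
        Real.sum_mul_le_sqrt_mul_sqrt _ _ _
    _ = _ := by rw [EuclideanSpace.norm_eq x]

namespace IsSupportingPencil

theorem norm_le (h : IsSupportingPencil F c₁ c₂ A v B) (i : Fin (k + 1)) :
    ‖B i‖ ≤ ‖F (Coord.{u} 1) (fun _ => (c₂ : ℂ) • 1)‖ / min 1 c₁ := by
  have h₀ := (norm_le_re_trace (h.nonneg 0)).trans h.trace_le
  refine Fin.cases h₀ (fun j => ?_) i
  have hnn : ∀ i, 0 ≤ B i := fun i => (nonneg_iff_isPositive _).2 (h.nonneg i)
  refine (CStarAlgebra.norm_le_norm_of_nonneg_of_le (hnn _) (le_trans ?_ h.sum_le)).trans h₀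
  exact Finset.single_le_sum (f := fun i : Fin k => B i.succ) (fun i _ => hnn i.succ)
    (Finset.mem_univ j)

variable {E : Type u} [NormedAddCommGroup E] [InnerProductSpace ℂ E] [CompleteSpace E]

theorem pencil_nonneg (h : IsSupportingPencil F c₁ c₂ A v B) (hF : IsFreeFunction F)
    {X : Fin k → (E →L[ℂ] E)} (hX : ∀ i, X i ∈ PosOp E) : 0 ≤ pencil B X := by
  have := h.nonneg_on_hypograph E 0 X ⟨.zero _, hX,
    (nonneg_iff_isPositive _).2 (PosOp.isPositive (hF.maps_to E X hX))⟩
  rw [TensorProduct.mapL_zero_right, sub_zero] at this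
  exact (nonneg_iff_isPositive _).2 this

variable [FiniteDimensional ℂ E]

/-- At the supporting point, the Schur complement of the pencil agrees with `F(A)` on the
vector `v`. -/
theorem schurBlock_apply_self (h : IsSupportingPencil F c₁ c₂ A v B) (hF : IsFreeFunction F)
    (hA : ∀ i, A i ∈ PosOp (Coord.{u} n)) (hv : ‖v‖ = 1) :
    schurBlock v B A (dualVec v ⊗ₜ[ℂ] v) = dualVec v ⊗ₜ[ℂ] F (Coord.{u} n) A v := by
  set Q := TensorProduct.mapL (dualProj v) (F (Coord.{u} n) A) with hQ
  have hpos : 0 ≤ pencil B A - Q := (nonneg_iff_isPositive _).2 <|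
    h.nonneg_on_hypograph _ _ A ⟨PosOp.isSelfAdjoint (hF.maps_to _ A hA), hA, le_rfl⟩
  have hker : (pencil B A - Q) (canonicalVec n) = 0 := by
    set s := sqrtOp (pencil B A - Q)
    have hss : s * s = pencil B A - Q := sqrtOp_mul_sqrtOp hpos
    have h₀ := h.singular
    rw [← hQ, ← hss, show ∀ x, (s * s) x = s (s x) from fun _ => rfl, ← adjoint_inner_left,
      (isSelfAdjoint_sqrtOp _).adjoint_eq, inner_self_eq_zero] at h₀
    rw [← hss, show ∀ x, (s * s) x = s (s x) from fun _ => rfl, h₀, map_zero]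
  rw [sub_apply, sub_eq_zero] at hker
  have hPQ : tensorProj (Coord.{u} n) v * Q = Q := by
    rw [tensorProj, hQ, ← TensorProduct.mapL_mul, dualProj_mul_self hv, one_mul]
  have hP := tensorProj_mul_self (E := Coord.{u} n) hv
  have e : dualVec v ⊗ₜ[ℂ] v = tensorProj (Coord.{u} n) v (canonicalVec n) := by
    rw [tensorProj, mapL_dualProj_canonicalVec, one_apply_eq_self]
  rw [schurBlock_eq, e, schurCompl_apply_range hP,
    schurCompl_apply_eq (isSelfAdjoint_tensorProj v) hP (h.pencil_nonneg hF hA) hPQ hker, hQ,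
    mapL_dualProj_canonicalVec]

variable {E' : Type u} [NormedAddCommGroup E'] [InnerProductSpace ℂ E'] [CompleteSpace E']
  [FiniteDimensional ℂ E']

/-- The Schur complements of a supporting pencil respect isometric and coisometric intertwiners
alike, since no assumption on `J` is needed. -/
theorem schurBlock_intertwine (h : IsSupportingPencil F c₁ c₂ A v B) (hF : IsFreeFunction F)
    {J : E →L[ℂ] E'} {X : Fin k → (E →L[ℂ] E)} {X' : Fin k → (E' →L[ℂ] E')}
    (hX : ∀ i, X i ∈ PosOp E) (hX' : ∀ i, X' i ∈ PosOp E') (hJ : ∀ i, X' i ∘L J = J ∘L X i) :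
    schurBlock v B X' ∘L TensorProduct.mapL 1 J = TensorProduct.mapL 1 J ∘L schurBlock v B X := by
  have hp := fun x y => pencil_intertwine hJ fun i => block (dualProj v) x y (B i)
  have hD : ∀ {E : Type u} [NormedAddCommGroup E] [InnerProductSpace ℂ E] [CompleteSpace E]
      [FiniteDimensional ℂ E] {X : Fin k → (E →L[ℂ] E)} (_ : ∀ i, X i ∈ PosOp E),
      IsSelfAdjoint (pencil (fun i => block (dualProj v) 1 1 (B i)) X) := by
    intro E _ _ _ _ X hX
    rw [pencil_block]
    exact (block_one_one_nonneg (isSelfAdjoint_tensorProj v) (h.pencil_nonneg hF hX)).isSelfAdjoint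
  have hG := genInv_intertwine (hD hX) (hD hX') (hp 1 1)
  simp only [schurBlock, mul_def, sub_comp, comp_sub, comp_assoc, hp]
  rw [← comp_assoc (genInv _) (TensorProduct.mapL 1 J), hG]
  simp only [← comp_assoc, hp]

/-- If the pencil supports `F` at a point `A` that contains `X` as a direct summand, embedded by
`J`, then the Schur complement at `X` agrees with `F(X)` on `J† v`. -/
theorem schurBlock_apply_adjoint (h : IsSupportingPencil F c₁ c₂ A v B) (hF : IsFreeFunction F)
    (hA : ∀ i, A i ∈ PosOp (Coord.{u} n)) (hv : ‖v‖ = 1) {X : Fin k → (E →L[ℂ] E)}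
    (hX : ∀ i, X i ∈ PosOp E) {J : E →L[ℂ] Coord.{u} n} (hJ : adjoint J ∘L J = 1)
    (hJA : ∀ i, A i ∘L J = J ∘L X i) :
    schurBlock v B X (dualVec v ⊗ₜ[ℂ] adjoint J v) =
      dualVec v ⊗ₜ[ℂ] F E X (adjoint J v) := by
  have hadj : ∀ {Y : E →L[ℂ] E} {C : Coord.{u} n →L[ℂ] Coord.{u} n}, IsSelfAdjoint Y →
      IsSelfAdjoint C → C ∘L J = J ∘L Y → Y ∘L adjoint J = adjoint J ∘L C := by
    intro Y C hY hC e
    have := congrArg adjoint e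
    rw [adjoint_comp, adjoint_comp, hY.adjoint_eq, hC.adjoint_eq] at this
    exact this.symm
  have h₁ := h.schurBlock_intertwine hF hA hX fun i =>
    hadj (PosOp.isSelfAdjoint (hX i)) (PosOp.isSelfAdjoint (hA i)) (hJA i)
  have h₂ := hadj (PosOp.isSelfAdjoint (hF.maps_to E X hX))
    (PosOp.isSelfAdjoint (hF.maps_to _ A hA)) (hF.intertwine hJ hX hA hJA)
  have h₃ := congrArg (fun f => f (dualVec v ⊗ₜ[ℂ] v)) h₁
  simp only [comp_apply, TensorProduct.mapL_tmul, one_apply_eq_self,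
    h.schurBlock_apply_self hF hA hv] at h₃
  rw [h₃]
  exact congrArg (fun f => dualVec v ⊗ₜ[ℂ] f v) h₂.symm

end IsSupportingPencil

end Supporting

/-! ### The block operators on `ℋ ⊗ E` -/

section Blocks

theorem norm_block_le {V : Type*} [NormedAddCommGroup V] [InnerProductSpace ℂ V]
    {P : V →L[ℂ] V} (hP : ‖P‖ ≤ 1) {M : V →L[ℂ] V} {C : ℝ} (hM : ‖M‖ ≤ C) (x y : Fin 2) :
    ‖block P x y M‖ ≤ 2 * C * 2 := by
  have h1 : ‖(1 : V →L[ℂ] V)‖ ≤ 1 := ContinuousLinearMap.norm_id_le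
  have h : ∀ x, ‖(![P, 1 - P] : Fin 2 → (V →L[ℂ] V)) x‖ ≤ 2 := by
    intro x
    fin_cases x
    · exact hP.trans one_le_two
    · exact (norm_sub_le _ _).trans ((add_le_add h1 hP).trans_eq one_add_one_eq_two)
  have hC : 0 ≤ C := (norm_nonneg _).trans hM
  refine (norm_mul_le _ _).trans (mul_le_mul ((norm_mul_le _ _).trans ?_) (h y) (norm_nonneg _)
    (by positivity))
  exact mul_le_mul (h x) hM (norm_nonneg _) zero_le_two

theorem norm_sqrtOp_le {V : Type*} [NormedAddCommGroup V] [InnerProductSpace ℂ V]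
    [CompleteSpace V] [FiniteDimensional ℂ V] {D : V →L[ℂ] V} (hD : 0 ≤ D) {C : ℝ}
    (h : ‖D‖ ≤ C) : ‖sqrtOp D‖ ≤ √C := by
  refine Real.le_sqrt_of_sq_le ?_
  rwa [sq, ← CStarRing.norm_star_mul_self, (isSelfAdjoint_sqrtOp D).star_eq, sqrtOp_mul_sqrtOp hD]

theorem isPositive_mul_self {V : Type*} [NormedAddCommGroup V] [InnerProductSpace ℂ V]
    {R : V →L[ℂ] V} (h : ∀ x y, ⟪R x, y⟫_ℂ = ⟪x, R y⟫_ℂ) : (R * R).IsPositive := by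
  refine ⟨fun x y => (h (R x) y).trans (h x (R y)), fun x => ?_⟩
  rw [reApplyInnerSelf_apply, mul_apply_eq_comp, h]
  exact inner_self_nonneg

theorem norm_dualProj {n : ℕ} {v : Coord.{u} n} (hv : ‖v‖ = 1) : ‖dualProj v‖ = 1 := by
  rw [dualProj, InnerProductSpace.norm_rankOne, norm_dualVec, hv, one_mul]

theorem norm_tensorProj_le {n : ℕ} {v : Coord.{u} n} (hv : ‖v‖ = 1) (E : Type*)
    [NormedAddCommGroup E] [InnerProductSpace ℂ E] : ‖tensorProj E v‖ ≤ 1 := by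
  refine (TensorProduct.norm_mapL_le _ _).trans ?_
  rw [norm_dualProj hv, one_mul]
  exact ContinuousLinearMap.norm_id_le

variable {k : ℕ} {c₁ c₂ : ℝ} {F : GradedFunction.{u} k} {B : PencilSystem.{u} k c₁ c₂}

theorem IsSupportingSystem.exists_isDirectSum_block (h : IsSupportingSystem F B) (x y : Fin 2)
    (i : Fin (k + 1)) : ∃ T : BigSpace.{u} k c₁ c₂ →L[ℂ] BigSpace.{u} k c₁ c₂,
      IsDirectSum T (fun ω => block (dualProj ω.v) x y (B ω i)) :=
  exists_isDirectSum fun ω =>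
    norm_block_le (norm_dualProj ω.norm_v).le ((h ω).norm_le i) x y

variable {E : Type u} [NormedAddCommGroup E] [InnerProductSpace ℂ E]

theorem IsSupportingSystem.norm_block_pencil_le (h : IsSupportingSystem F B)
    (X : Fin k → (E →L[ℂ] E)) (x y : Fin 2) (ω : Index.{u} k c₁ c₂) :
    ‖block (tensorProj E ω.v) x y (pencil (B ω) X)‖ ≤
      2 * (‖F (Coord.{u} 1) (fun _ => (c₂ : ℂ) • 1)‖ / min 1 c₁ *
        (1 + ∑ i : Fin k, ‖X i - 1‖)) * 2 :=
  norm_block_le (norm_tensorProj_le ω.norm_v E) (norm_pencil_le (h ω).norm_le X) x y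

variable [FiniteDimensional ℂ E]

/-- If `L` is the direct sum of positive operators `M ω`, cut into blocks by projections `P ω`,
then the product `L₁₂ L₂₂⁻¹ L₂₁` exists and is the direct sum of the corresponding products over
the summands. The square roots of the diagonal blocks and the operators `L₂₂^{-1/2} L₂₁` are
uniformly bounded, so each of them sums up to a bounded operator, although the inverses of the
diagonal blocks do not. -/
theorem exists_isInverseSandwich
    {P M : ∀ ω : Index.{u} k c₁ c₂, Coord.{u} ω.n ⊗[ℂ] E →L[ℂ] Coord.{u} ω.n ⊗[ℂ] E}
    (hP : ∀ ω, IsSelfAdjoint (P ω)) (hPP : ∀ ω, P ω * P ω = P ω) (hM : ∀ ω, 0 ≤ M ω) {C : ℝ}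
    (hbd : ∀ x y ω, ‖block (P ω) x y (M ω)‖ ≤ C)
    {L : Fin 2 → Fin 2 → (BigSpace.{u} k c₁ c₂ ⊗[ℂ] E →L[ℂ] BigSpace.{u} k c₁ c₂ ⊗[ℂ] E)}
    (hL : ∀ x y, IsDirectSumTensor (L x y) (fun ω => block (P ω) x y (M ω))) :
    ∃ Q, IsDirectSumTensor (L 0 0 - Q) (fun ω => schurCompl (P ω) (M ω)) ∧
      IsInverseSandwich (L 0 1) (L 1 1) (L 1 0) Q := by
  have hD : ∀ ω, 0 ≤ block (P ω) 1 1 (M ω) := fun ω => block_one_one_nonneg (hP ω) (hM ω)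
  -- The fourth root of `L₂₂` exhibits its square root as the square of a symmetric operator.
  obtain ⟨R, hR⟩ := exists_isDirectSumTensor
    (t := fun ω => sqrtOp (sqrtOp (block (P ω) 1 1 (M ω)))) fun ω =>
    norm_sqrtOp_le (sqrtOp_nonneg _) (norm_sqrtOp_le (hD ω) (hbd 1 1 ω))
  have hS : IsDirectSumTensor (R * R) (fun ω => sqrtOp (block (P ω) 1 1 (M ω))) :=
    (hR.mul hR).congr fun ω => sqrtOp_mul_sqrtOp (sqrtOp_nonneg _)
  have hn : ∀ ω, ‖sqrtInvOp (block (P ω) 1 1 (M ω)) * block (P ω) 1 0 (M ω)‖ ≤ √C := fun ω =>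
    Real.le_sqrt_of_sq_le ((norm_sqrtInvOp_mul_block_sq_le (hP ω) (hPP ω) (hM ω)).trans
      (hbd 0 0 ω))
  have hstar : ∀ ω, block (P ω) 0 1 (M ω) * sqrtInvOp (block (P ω) 1 1 (M ω)) =
      adjoint (sqrtInvOp (block (P ω) 1 1 (M ω)) * block (P ω) 1 0 (M ω)) := fun ω => by
    rw [← star_eq_adjoint, star_mul, block_star (hP ω) (hM ω).isSelfAdjoint,
      (isSelfAdjoint_sqrtInvOp _).star_eq]
  obtain ⟨C₂₁, h₂₁⟩ := exists_isDirectSumTensor hn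
  obtain ⟨C₁₂, h₁₂⟩ := exists_isDirectSumTensor
    (t := fun ω => block (P ω) 0 1 (M ω) * sqrtInvOp (block (P ω) 1 1 (M ω))) fun ω =>
      ((congrArg norm (hstar ω)).trans (LinearIsometryEquiv.norm_map adjoint _)).trans_le (hn ω)
  have hRR : ∀ x y, ⟪R x, y⟫_ℂ = ⟪x, R y⟫_ℂ := hR.inner_left hR fun ω a c => by
    rw [← adjoint_inner_right, (isSelfAdjoint_sqrtOp _).adjoint_eq]
  have hker : ∀ x, (R * R) x = 0 → C₁₂ x = 0 := by
    intro x hx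
    refine ext_projTensor fun ω => ?_
    have h₀ : sqrtOp (block (P ω) 1 1 (M ω)) (projTensor E ω x) = 0 := by
      rw [← hS.projTensor_apply, hx, map_zero]
    have e : block (P ω) 0 1 (M ω) * sqrtInvOp (block (P ω) 1 1 (M ω)) =
        block (P ω) 0 1 (M ω) * sqrtInvOp (block (P ω) 1 1 (M ω)) *
          genInv (block (P ω) 1 1 (M ω)) * sqrtOp (block (P ω) 1 1 (M ω)) *
            sqrtOp (block (P ω) 1 1 (M ω)) := by
      rw [mul_assoc _ (sqrtOp _), sqrtOp_mul_sqrtOp (hD ω), mul_assoc _ (genInv _),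
        mul_assoc _ (sqrtInvOp _), sqrtInvOp_mul_genInv_mul (hD ω)]
    rw [h₁₂.projTensor_apply, e, mul_apply_eq_comp, h₀, map_zero]
  have hQ : IsDirectSumTensor (C₁₂ * C₂₁) (fun ω =>
      block (P ω) 0 1 (M ω) * genInv (block (P ω) 1 1 (M ω)) * block (P ω) 1 0 (M ω)) :=
    (h₁₂.mul h₂₁).congr fun ω => by
      rw [mul_assoc, ← mul_assoc (sqrtInvOp _), sqrtInvOp_mul_sqrtInvOp (hD ω), mul_assoc]
  have h₁₁ : R * R * (R * R) = L 1 1 :=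
    (hS.mul hS).unique ((hL 1 1).congr fun ω => (sqrtOp_mul_sqrtOp (hD ω)).symm)
  have h₁₀ : L 1 0 = R * R * C₂₁ := (hL 1 0).unique ((hS.mul h₂₁).congr fun ω => by
    rw [← mul_assoc, sqrtOp_mul_sqrtInvOp (hD ω), mul_genInv_mul_block (hP ω) (hM ω)])
  have h₀₁ : L 0 1 = C₁₂ * (R * R) := (hL 0 1).unique ((h₁₂.mul hS).congr fun ω => by
    rw [mul_assoc, sqrtInvOp_mul_sqrtOp (hD ω), block_mul_genInv_mul (hP ω) (hM ω)])
  refine ⟨C₁₂ * C₂₁, (hL 0 0).sub hQ, R * R, C₁₂, C₂₁, isPositive_mul_self hRR, h₁₁, h₁₀,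
    fun x => ?_, h₀₁, hker, rfl⟩
  rw [Submodule.mem_orthogonal]
  intro z hz
  rw [← h₁₂.inner_left h₂₁ fun ω a c => ?_, hker z hz, inner_zero_left]
  rw [hstar, adjoint_inner_left]

variable [CompleteSpace E]

theorem IsSupportingSystem.exists_isInverseSandwich (h : IsSupportingSystem F B)
    (hF : IsFreeFunction F) {X : Fin k → (E →L[ℂ] E)} (hX : ∀ i, X i ∈ PosOp E)
    {b : Fin 2 → Fin 2 → Fin (k + 1) → (BigSpace.{u} k c₁ c₂ →L[ℂ] BigSpace.{u} k c₁ c₂)}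
    (hb : ∀ x y i, IsDirectSum (b x y i) (fun ω => block (dualProj ω.v) x y (B ω i))) :
    ∃ Q : BigSpace.{u} k c₁ c₂ ⊗[ℂ] E →L[ℂ] BigSpace.{u} k c₁ c₂ ⊗[ℂ] E,
      IsDirectSumTensor (pencil (b 0 0) X - Q) (fun ω => schurBlock ω.v (B ω) X) ∧
      IsInverseSandwich (pencil (b 0 1) X) (pencil (b 1 1) X) (pencil (b 1 0) X) Q := by
  obtain ⟨Q, hQ, hQ'⟩ := FreeLoewner.exists_isInverseSandwich
    (P := fun ω : Index.{u} k c₁ c₂ => tensorProj E ω.v) (M := fun ω => pencil (B ω) X)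
    (L := fun x y => pencil (b x y) X) (fun ω => isSelfAdjoint_tensorProj ω.v)
    (fun ω => tensorProj_mul_self ω.norm_v) (fun ω => (h ω).pencil_nonneg hF hX)
    (h.norm_block_pencil_le X)
    (fun x y => (isDirectSumTensor_pencil (hb x y) X).congr fun ω => pencil_block _ _ _ _ _)
  exact ⟨Q, hQ.congr fun ω => (schurBlock_eq _ _ _).symm, hQ'⟩

end Blocks

/-! ### States determined by finitely many conditions at a time -/

section States

variable {H : Type*} [NormedAddCommGroup H] [InnerProductSpace ℂ H]

/-- The functional `T ↦ ⟪ξ, T ξ⟫`. -/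
def vectorState (ξ : H) : StrongDual ℂ (H →L[ℂ] H) :=
  innerSL ℂ ξ ∘L ContinuousLinearMap.apply ℂ H ξ

/-- If every finite subset of a family of linear conditions is satisfied by some vector state,
then the whole family is satisfied by some state: the set of states is weak-* compact. -/
theorem exists_isState_of_forall_finset {ι : Type*} (T : ι → (H →L[ℂ] H)) (z : ι → ℂ)
    (h : ∀ s : Finset ι, ∃ ξ : H, ‖ξ‖ = 1 ∧ ∀ i ∈ s, ⟪ξ, T i ξ⟫_ℂ = z i) :
    ∃ w : StrongDual ℂ (H →L[ℂ] H), IsState w ∧ ∀ i, w (T i) = z i := by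
  set S : Set (WeakDual ℂ (H →L[ℂ] H)) :=
    WeakDual.toStrongDual ⁻¹' Metric.closedBall 0 1 ∩
      ({w | w 1 = 1} ∩ ⋂ (A : H →L[ℂ] H) (_ : A.IsPositive), {w | 0 ≤ w A}) with hS
  have hSc : IsCompact S := by
    refine (WeakDual.isCompact_closedBall 0 1).inter_right (IsClosed.inter ?_ ?_)
    · exact isClosed_eq (WeakDual.eval_continuous _) continuous_const
    · exact isClosed_iInter fun A => isClosed_iInter fun _ =>
        isClosed_le continuous_const (WeakDual.eval_continuous A)
  obtain ⟨w, ⟨-, hw₁, hw₀⟩, hw⟩ := hSc.inter_iInter_nonempty (fun i => {w | w (T i) = z i})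
    (fun i => isClosed_eq (WeakDual.eval_continuous _) continuous_const) fun s => by
      obtain ⟨ξ, hξ, hs⟩ := h s
      refine ⟨StrongDual.toWeakDual (vectorState ξ), ⟨?_, ?_, ?_⟩, ?_⟩
      · refine (dist_zero_right (vectorState ξ)).trans_le ?_
        refine opNorm_le_bound _ zero_le_one fun A => ?_
        calc ‖⟪ξ, A ξ⟫_ℂ‖ ≤ ‖ξ‖ * (‖A‖ * ‖ξ‖) :=
              (norm_inner_le_norm _ _).trans
                (mul_le_mul_of_nonneg_left (le_opNorm _ _) (norm_nonneg _))
          _ = 1 * ‖A‖ := by rw [hξ]; ring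
      · change ⟪ξ, ξ⟫_ℂ = 1
        rw [inner_self_eq_norm_sq_to_K, hξ]
        norm_num
      · simp only [Set.mem_iInter]
        exact fun A hA => hA.inner_nonneg_right ξ
      · simp only [Set.mem_iInter]
        exact hs
  refine ⟨WeakDual.toStrongDual w, ⟨hw₁, fun A hA => ?_⟩, fun i => ?_⟩
  · simp only [Set.mem_iInter] at hw₀
    exact hw₀ A hA
  · simp only [Set.mem_iInter] at hw
    exact hw i

end States

/-! ### Direct sums of finitely many matrix tuples -/

section FiniteSum

variable {k : ℕ} {c₁ c₂ : ℝ}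

/-- An arbitrary finite-dimensional Hilbert space is isometric to some `ℂⁿ`. -/
def toCoord (E : Type*) [NormedAddCommGroup E] [InnerProductSpace ℂ E] [FiniteDimensional ℂ E] :
    E ≃ₗᵢ[ℂ] Coord.{u} (Module.finrank ℂ E) :=
  ((stdOrthonormalBasis ℂ E).reindex Equiv.ulift.symm).repr

/-- The interval `ℙ_{c₁,c₂}` is closed under operator convex combinations. -/
theorem sum_conj_mem_posOpIcc {E' : Type*} [NormedAddCommGroup E'] [InnerProductSpace ℂ E']
    [CompleteSpace E'] (hc₁ : 0 < c₁) {τ : Type*} [Fintype τ] {E : τ → Type*}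
    [∀ t, NormedAddCommGroup (E t)] [∀ t, InnerProductSpace ℂ (E t)] [∀ t, CompleteSpace (E t)] {X : ∀ t, E t →L[ℂ] E t}
    (hX : ∀ t, X t ∈ PosOpIcc c₁ c₂ (E t)) (J : ∀ t, E t →L[ℂ] E')
    (hJ : ∑ t, J t ∘L adjoint (J t) = 1) :
    ∑ t, J t ∘L X t ∘L adjoint (J t) ∈ PosOpIcc c₁ c₂ E' := by
  have hc : ∀ c : ℝ, (c : ℂ) • (1 : E' →L[ℂ] E') =
      ∑ t, J t ∘L ((c : ℂ) • (1 : E t →L[ℂ] E t)) ∘L adjoint (J t) := by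
    intro c
    rw [← hJ, Finset.smul_sum]
    refine Finset.sum_congr rfl fun t _ => ?_
    ext x
    simp
  have hle : ∀ {A B : ∀ t, E t →L[ℂ] E t}, (∀ t, A t ≤ B t) →
      ∑ t, J t ∘L A t ∘L adjoint (J t) ≤ ∑ t, J t ∘L B t ∘L adjoint (J t) := by
    intro A B h
    refine Finset.sum_le_sum fun t _ => ?_
    have := ((ContinuousLinearMap.le_def _ _).1 (h t)).conj_adjoint (J t)
    rw [ContinuousLinearMap.le_def]
    simpa only [sub_comp, comp_sub] using this
  have h₁ : (c₁ : ℂ) • (1 : E' →L[ℂ] E') ≤ ∑ t, J t ∘L X t ∘L adjoint (J t) :=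
    (hc c₁).trans_le (hle fun t => (hX t).2.1)
  exact ⟨PosOp.of_le (posOp_real_smul_one hc₁) h₁, h₁,
    (hle fun t => (hX t).2.2).trans_eq (hc c₂).symm⟩

/-- The Hilbert space direct sum of finitely many spaces `ℂᵐ`, realized as some `ℂⁿ`. -/
theorem exists_isometries {τ : Type u} [Fintype τ] (m : τ → ℕ) :
    ∃ (n : ℕ) (J : ∀ t, Coord.{u} (m t) →L[ℂ] Coord.{u} n),
      (∀ t z, adjoint (J t) (J t z) = z) ∧
      (∀ s t, s ≠ t → ∀ z, adjoint (J s) (J t z) = 0) ∧ ∑ t, J t ∘L adjoint (J t) = 1 := by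
  classical
  set W := PiLp 2 fun t => Coord.{u} (m t)
  set Φ := toCoord.{u} W
  set K : ∀ t, Coord.{u} (Module.finrank ℂ W) →L[ℂ] Coord.{u} (m t) := fun t =>
    PiLp.proj 2 (fun t => Coord.{u} (m t)) t ∘L Φ.symm.toContinuousLinearEquiv.toContinuousLinearMap
  have hK : ∀ t x, K t x = Φ.symm x t := fun _ _ => rfl
  have hKadj : ∀ t z, adjoint (K t) z = Φ (PiLp.single 2 t z) := by
    intro t z
    refine ext_inner_left ℂ fun a => ?_
    rw [adjoint_inner_right, ← Φ.symm.inner_map_map a, Φ.symm_apply_apply,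
      PiLp.inner_apply (Φ.symm a), Finset.sum_eq_single t, hK]
    · simp
    · intro s _ hs
      simp [hs]
    · simp
  refine ⟨_, fun t => adjoint (K t), fun t z => ?_, fun s t hst z => ?_, ?_⟩
  · rw [adjoint_adjoint, hKadj, hK, Φ.symm_apply_apply]
    simp
  · rw [adjoint_adjoint, hKadj, hK, Φ.symm_apply_apply]
    simp [hst]
  · refine ContinuousLinearMap.ext fun x => ext_inner_left ℂ fun a => ?_
    simp only [sum_apply, comp_apply, inner_sum, adjoint_inner_right, adjoint_adjoint,
      one_apply_eq_self]
    rw [← Φ.symm.inner_map_map a, PiLp.inner_apply]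
    rfl

/-- Finitely many tuples `X t`, and vectors `y t` not all of which vanish, are direct summands of
the tuple `A` and of a multiple of the unit vector `v` at a single index `(n, A, v)`. -/
theorem exists_index_of_fintype (hc₁ : 0 < c₁) {τ : Type u} [Fintype τ] {m : τ → ℕ}
    {X : ∀ t, Fin k → (Coord.{u} (m t) →L[ℂ] Coord.{u} (m t))}
    (hX : ∀ t i, X t i ∈ PosOpIcc c₁ c₂ (Coord.{u} (m t)))
    {y : ∀ t, Coord.{u} (m t)} (hy : y ≠ 0) :
    ∃ ω : Index.{u} k c₁ c₂, ∀ t, ∃ J : Coord.{u} (m t) →L[ℂ] Coord.{u} ω.n,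
      adjoint J ∘L J = 1 ∧ (∀ i, ω.A i ∘L J = J ∘L X t i) ∧
      ∃ c : ℂ, y t = c • adjoint J ω.v := by
  obtain ⟨n, J, hJ, hJ', hsum⟩ := exists_isometries m
  set p := ∑ t, J t (y t) with hpdef
  have hJp : ∀ t, adjoint (J t) p = y t := by
    intro t
    rw [hpdef, map_sum, Finset.sum_eq_single t, hJ]
    · exact fun s _ hs => hJ' t s hs.symm _
    · exact fun h => absurd (Finset.mem_univ t) h
  have hp : ‖p‖ ≠ 0 := fun h => hy <| funext fun t => by
    rw [← hJp, norm_eq_zero.1 h, map_zero, Pi.zero_apply]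
  have hA : ∀ i, ∑ t, J t ∘L X t i ∘L adjoint (J t) ∈ PosOpIcc c₁ c₂ (Coord.{u} n) := fun i =>
    sum_conj_mem_posOpIcc (E := fun t => Coord.{u} (m t)) hc₁ (fun t => hX t i) J hsum
  have hv : ‖((‖p‖⁻¹ : ℝ) : ℂ) • p‖ = 1 := by
    rw [norm_smul, Complex.norm_real, norm_inv, norm_norm, inv_mul_cancel₀ hp]
  refine ⟨⟨n, _, _, hA, hv⟩, fun t => ⟨J t, ContinuousLinearMap.ext (hJ t), fun i => ?_,
    (‖p‖ : ℂ), ?_⟩⟩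
  · refine ContinuousLinearMap.ext fun z => ?_
    simp only [comp_apply, sum_apply]
    rw [Finset.sum_eq_single t, hJ]
    · intro s _ hs
      rw [hJ' s t hs, map_zero, map_zero]
    · exact fun h => absurd (Finset.mem_univ t) h
  · rw [map_smul, smul_smul, hJp, ← Complex.ofReal_mul, mul_inv_cancel₀ hp, Complex.ofReal_one,
      one_smul]

end FiniteSum

/-! ### The representing state -/

section Representation

variable {k : ℕ} {c₁ c₂ : ℝ} {F : GradedFunction.{u} k} {B : PencilSystem.{u} k c₁ c₂}

/-- For finitely many matrix tuples `X` and pairs of vectors `x`, `y`, a single vector state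
recovers all the numbers `⟪x, F(X) y⟫`. -/
theorem IsSupportingSystem.exists_vector (h : IsSupportingSystem F B) (hF : IsFreeFunction F)
    (hc₁ : 0 < c₁) (hc₂ : c₁ ≤ c₂) {τ : Type u} [Finite τ] {m : τ → ℕ}
    {X : ∀ t, Fin k → (Coord.{u} (m t) →L[ℂ] Coord.{u} (m t))}
    (hX : ∀ t i, X t i ∈ PosOpIcc c₁ c₂ (Coord.{u} (m t))) (x y : ∀ t, Coord.{u} (m t)) :
    ∃ ξ : BigSpace.{u} k c₁ c₂, ‖ξ‖ = 1 ∧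
      ∀ t T, IsDirectSum T (fun ω => compress (x t) (y t) (schurBlock ω.v (B ω) (X t))) →
        ⟪ξ, T ξ⟫_ℂ = ⟪x t, F (Coord.{u} (m t)) (X t) (y t)⟫_ℂ := by
  have := Fintype.ofFinite τ
  -- The additional summand `(1, c₁, e₀)` ensures that the vectors do not all vanish.
  let X' : ∀ t : Option τ, Fin k →
      (Coord.{u} (t.elim 1 m) →L[ℂ] Coord.{u} (t.elim 1 m)) := fun t =>
    match t with
    | none => fun _ => (c₁ : ℂ) • 1
    | some t => X t
  let y' : ∀ t : Option τ, Coord.{u} (t.elim 1 m) := fun t =>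
    match t with
    | none => EuclideanSpace.single ⟨(0 : Fin 1)⟩ 1
    | some t => y t
  have hX' : ∀ t i, X' t i ∈ PosOpIcc c₁ c₂ (Coord.{u} (t.elim 1 m)) := by
    intro t i
    cases t with
    | none =>
      refine ⟨posOp_real_smul_one hc₁, le_rfl, ?_⟩
      refine le_of_re_inner_le (isSelfAdjoint_real_smul_one _) (isSelfAdjoint_real_smul_one _)
        fun z => ?_
      rw [re_inner_real_smul_one, re_inner_real_smul_one]
      exact mul_le_mul_of_nonneg_right hc₂ (sq_nonneg _)
    | some t => exact hX t i
  have hy' : y' ≠ 0 := fun h₀ => by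
    have e : (EuclideanSpace.single ⟨(0 : Fin 1)⟩ 1 : Coord.{u} 1) = 0 := congrFun h₀ none
    simp at e
  obtain ⟨ω, hω⟩ := exists_index_of_fintype hc₁ hX' hy'
  have hv : ‖dualVec ω.v‖ = 1 := (norm_dualVec _).trans ω.norm_v
  refine ⟨incl ω (dualVec ω.v), (norm_incl _ _).trans hv, fun t T hT => ?_⟩
  obtain ⟨J, hJ, hA, c, hc⟩ : ∃ J : Coord.{u} (m t) →L[ℂ] Coord.{u} ω.n, adjoint J ∘L J = 1 ∧
    (∀ i, ω.A i ∘L J = J ∘L X t i) ∧ ∃ c : ℂ, y t = c • adjoint J ω.v := hω (some t)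
  have hs := (h ω).schurBlock_apply_adjoint hF (fun i => (ω.A_mem i).1) ω.norm_v
    (fun i => (hX t i).1) hJ hA
  have hs' : schurBlock ω.v (B ω) (X t) (dualVec ω.v ⊗ₜ y t) =
      dualVec ω.v ⊗ₜ F (Coord.{u} (m t)) (X t) (y t) := by
    rw [hc, TensorProduct.tmul_smul, map_smul, map_smul, TensorProduct.tmul_smul, hs]
  rw [hT, inner_incl, incl_apply_self, inner_compress, hs', TensorProduct.inner_tmul,
    inner_self_eq_norm_sq_to_K, hv]
  norm_num

/-- There is a state `w` such that `w ⊗ I` recovers `F(X)` from the direct sum of the Schur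
complements at `X`, for all matrix tuples `X`. -/
theorem IsSupportingSystem.exists_isState_coord (h : IsSupportingSystem F B)
    (hF : IsFreeFunction F) (hc₁ : 0 < c₁) (hc₂ : c₁ ≤ c₂) :
    ∃ w : StrongDual ℂ (BigSpace.{u} k c₁ c₂ →L[ℂ] BigSpace.{u} k c₁ c₂), IsState w ∧
      ∀ (m : ℕ) (X : Fin k → (Coord.{u} m →L[ℂ] Coord.{u} m)),
        (∀ i, X i ∈ PosOpIcc c₁ c₂ (Coord.{u} m)) → ∀ x y T,
        IsDirectSum T (fun ω => compress x y (schurBlock ω.v (B ω) X)) →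
        w T = ⟪x, F (Coord.{u} m) X y⟫_ℂ := by
  let ι : Type u := Σ m : ℕ, {X : Fin k → (Coord.{u} m →L[ℂ] Coord.{u} m) //
    ∀ i, X i ∈ PosOpIcc c₁ c₂ (Coord.{u} m)} × Coord.{u} m × Coord.{u} m
  choose b hb using h.exists_isDirectSum_block
  have hT : ∀ s : ι, ∃ T, IsDirectSum T
      (fun ω => compress s.2.2.1 s.2.2.2 (schurBlock ω.v (B ω) s.2.1.1)) := by
    intro s
    obtain ⟨Q, hQ, -⟩ := h.exists_isInverseSandwich hF (fun i => (s.2.1.2 i).1) hb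
    exact ⟨_, hQ.compress _ _⟩
  choose T hT using hT
  obtain ⟨w, hw, hwT⟩ := exists_isState_of_forall_finset T
    (fun s => ⟪s.2.2.1, F (Coord.{u} s.1) s.2.1.1 s.2.2.2⟫_ℂ) fun s => by
      obtain ⟨ξ, hξ, hs⟩ := h.exists_vector hF hc₁ hc₂ (τ := s) (X := fun t => t.1.2.1.1)
        (fun t => t.1.2.1.2) (fun t => t.1.2.2.1) (fun t => t.1.2.2.2)
      exact ⟨ξ, hξ, fun i hi => hs ⟨i, hi⟩ _ (hT i)⟩
  refine ⟨w, hw, fun m X hX x y T' hT' => ?_⟩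
  rw [hT'.unique (hT ⟨m, ⟨X, hX⟩, x, y⟩), hwT]

/-- A version of `IsSupportingSystem.exists_isState_coord` for all finite-dimensional spaces. -/
theorem IsSupportingSystem.exists_isState (h : IsSupportingSystem F B)
    (hF : IsFreeFunction F) (hc₁ : 0 < c₁) (hc₂ : c₁ ≤ c₂) :
    ∃ w : StrongDual ℂ (BigSpace.{u} k c₁ c₂ →L[ℂ] BigSpace.{u} k c₁ c₂), IsState w ∧
      ∀ (E : Type u) [NormedAddCommGroup E] [InnerProductSpace ℂ E] [CompleteSpace E]
        [FiniteDimensional ℂ E] (X : Fin k → (E →L[ℂ] E)), (∀ i, X i ∈ PosOpIcc c₁ c₂ E) →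
        ∀ Ψ, IsDirectSumTensor Ψ (fun ω => schurBlock ω.v (B ω) X) → F E X = slice w Ψ := by
  obtain ⟨w, hw, hwX⟩ := h.exists_isState_coord hF hc₁ hc₂
  refine ⟨w, hw, fun E _ _ _ _ X hX Ψ hΨ => ?_⟩
  set Φ := toCoord.{u} E
  set J : E →L[ℂ] Coord.{u} (Module.finrank ℂ E) := Φ.toContinuousLinearEquiv.toContinuousLinearMap
  have hJ₁ : adjoint J ∘L J = 1 := by
    refine ContinuousLinearMap.ext fun z => ext_inner_left ℂ fun a => ?_
    rw [comp_apply, adjoint_inner_right]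
    exact Φ.inner_map_map a z
  have hJ₂ : J ∘L adjoint J = 1 := by
    refine ContinuousLinearMap.ext fun z => ?_
    obtain ⟨a, rfl⟩ := Φ.surjective z
    exact congrArg J (congrArg (fun f => f a) hJ₁)
  have hX' : ∀ i, J ∘L X i ∘L adjoint J ∈ PosOpIcc c₁ c₂ (Coord.{u} (Module.finrank ℂ E)) := by
    intro i
    simpa using sum_conj_mem_posOpIcc (τ := Unit) hc₁ (fun _ => hX i) (fun _ => J)
      (by simpa using hJ₂)
  have hJX : ∀ i, (J ∘L X i ∘L adjoint J) ∘L J = J ∘L X i := fun i => by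
    rw [comp_assoc, comp_assoc, hJ₁]
    rfl
  have hFJ := hF.intertwine hJ₁ (fun i => (hX i).1) (fun i => (hX' i).1) hJX
  refine ContinuousLinearMap.ext fun y => ext_inner_left ℂ fun x => ?_
  have hT : IsDirectSum (compress x y Ψ) (fun ω => compress (J x) (J y)
      (schurBlock ω.v (B ω) fun i => J ∘L X i ∘L adjoint J)) := by
    intro ω a
    rw [hΨ.compress x y ω a]
    refine congrArg (incl ω) (ext_inner_left ℂ fun c => ?_)
    have hs := congrArg (fun f => f (a ⊗ₜ y)) <|
      (h ω).schurBlock_intertwine hF (fun i => (hX i).1) (fun i => (hX' i).1) hJX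
    simp only [comp_apply, TensorProduct.mapL_tmul, one_apply_eq_self] at hs
    rw [inner_compress, inner_compress, hs]
    generalize schurBlock ω.v (B ω) X (a ⊗ₜ y) = z
    induction z using TensorProduct.induction_on with
    | zero => simp
    | tmul b d =>
      rw [TensorProduct.mapL_tmul, TensorProduct.inner_tmul, TensorProduct.inner_tmul]
      exact congrArg _ (Φ.inner_map_map x d).symm
    | add z w hz hw => rw [map_add, inner_add_right, inner_add_right, hz, hw]
  rw [inner_slice, hwX _ _ hX' _ _ _ hT, show F _ _ (J y) = J (F E X y) from
    congrArg (fun f => f y) hFJ]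
  exact (Φ.inner_map_map x _).symm

theorem slice_sub {H E : Type*} [NormedAddCommGroup H] [InnerProductSpace ℂ H]
    [NormedAddCommGroup E] [InnerProductSpace ℂ E] [FiniteDimensional ℂ E]
    (w : StrongDual ℂ (H →L[ℂ] H)) (S T : H ⊗[ℂ] E →L[ℂ] H ⊗[ℂ] E) :
    slice w (S - T) = slice w S - slice w T := by
  refine ContinuousLinearMap.ext fun y => ext_inner_left ℂ fun x => ?_
  rw [sub_apply, inner_sub_right, inner_slice, inner_slice, inner_slice, ← map_sub]
  refine congrArg w (ContinuousLinearMap.ext fun a => ext_inner_left ℂ fun c => ?_)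
  rw [sub_apply, inner_sub_right, inner_compress, inner_compress, inner_compress, sub_apply,
    inner_sub_right]

/-- The slice map acts on a pencil coefficientwise. -/
theorem slice_pencil {H E : Type*} [NormedAddCommGroup H] [InnerProductSpace ℂ H]
    [NormedAddCommGroup E] [InnerProductSpace ℂ E] [FiniteDimensional ℂ E]
    (w : StrongDual ℂ (H →L[ℂ] H)) (b : Fin (k + 1) → (H →L[ℂ] H)) (X : Fin k → (E →L[ℂ] E)) :
    slice w (pencil b X) = w (b 0) • (1 : E →L[ℂ] E) + ∑ i : Fin k, w (b i.succ) • (X i - 1) := by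
  refine ContinuousLinearMap.ext fun y => ext_inner_left ℂ fun x => ?_
  have e : compress x y (pencil b X) =
      ⟪x, y⟫_ℂ • b 0 + ∑ i : Fin k, ⟪x, (X i - 1) y⟫_ℂ • b i.succ := by
    refine ContinuousLinearMap.ext fun a => ext_inner_left ℂ fun c => ?_
    rw [inner_compress, pencil]
    simp only [add_apply, sum_apply, inner_add_right, inner_sum, TensorProduct.mapL_tmul,
      TensorProduct.inner_tmul, smul_apply, inner_smul_right, one_apply_eq_self, mul_comm]
  rw [inner_slice, e]
  simp only [map_add, map_sum, map_smul, add_apply, sum_apply, inner_add_right, inner_sum,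
    smul_apply, inner_smul_right, one_apply_eq_self, smul_eq_mul, mul_comm]

end Representation

end FreeLoewner

end

theorem theorem4p6 {k : ℕ} (hk : 0 < k) (F : FreeLoewner.GradedFunction.{u} k)
    (hF : FreeLoewner.IsFreeFunction F) (hmono : FreeLoewner.IsOperatorMonotone F)
    (c₁ c₂ : ℝ) (hc₁ : 0 < c₁) (hc₂ : c₁ < c₂) :
    (∃ B : FreeLoewner.PencilSystem.{u} k c₁ c₂, FreeLoewner.IsSupportingSystem F B) ∧
    ∀ B : FreeLoewner.PencilSystem.{u} k c₁ c₂, FreeLoewner.IsSupportingSystem F B →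
      ∃ b : Fin 2 → Fin 2 → Fin (k + 1) →
          (FreeLoewner.BigSpace.{u} k c₁ c₂ →L[ℂ] FreeLoewner.BigSpace.{u} k c₁ c₂),
        (∀ x y i, FreeLoewner.IsDirectSum (b x y i)
          (fun ω => FreeLoewner.block (FreeLoewner.dualProj ω.v) x y (B ω i))) ∧
        ∃ w : StrongDual ℂ
            (FreeLoewner.BigSpace.{u} k c₁ c₂ →L[ℂ] FreeLoewner.BigSpace.{u} k c₁ c₂),
          FreeLoewner.IsState w ∧
          ∀ (E : Type u) [NormedAddCommGroup E] [InnerProductSpace ℂ E] [CompleteSpace E]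
            [FiniteDimensional ℂ E] (X : Fin k → (E →L[ℂ] E)),
            (∀ i, X i ∈ FreeLoewner.PosOpIcc c₁ c₂ E) →
            ∃ Ψ Q : FreeLoewner.BigSpace.{u} k c₁ c₂ ⊗[ℂ] E →L[ℂ]
                FreeLoewner.BigSpace.{u} k c₁ c₂ ⊗[ℂ] E,
              FreeLoewner.IsDirectSumTensor Ψ
                (fun ω => FreeLoewner.schurBlock ω.v (B ω) X) ∧
              F E X = FreeLoewner.slice w Ψ ∧
              FreeLoewner.IsInverseSandwich (FreeLoewner.pencil (b 0 1) X)
                (FreeLoewner.pencil (b 1 1) X) (FreeLoewner.pencil (b 1 0) X) Q ∧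
              F E X = w (b 0 0 0) • (1 : E →L[ℂ] E) +
                (∑ i : Fin k, w (b 0 0 i.succ) • (X i - 1)) - FreeLoewner.slice w Q := by
  refine ⟨⟨fun ω => (FreeLoewner.exists_supportingPencil hF hmono hc₁ hc₂ ω.A_mem
    ω.norm_v).choose, fun ω => (FreeLoewner.exists_supportingPencil hF hmono hc₁ hc₂ ω.A_mem
    ω.norm_v).choose_spec⟩, fun B h => ?_⟩
  choose b hb using h.exists_isDirectSum_block
  obtain ⟨w, hw, hwX⟩ := h.exists_isState hF hc₁ hc₂.le
  refine ⟨b, hb, w, hw, fun E _ _ _ _ X hX => ?_⟩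
  obtain ⟨Q, hΨ, hQ⟩ := h.exists_isInverseSandwich hF (fun i => (hX i).1) hb
  have hFX := hwX E X hX _ hΨ
  refine ⟨_, Q, hΨ, hFX, hQ, ?_⟩
  rw [hFX, FreeLoewner.slice_sub, FreeLoewner.slice_pencil]
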